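/- Let $K$ be an algebraically closed field of characteristic $0$ (for instance $K=\mathbb{C}$), let $\mathcal{O}=K[[x,y]]$, $S=\operatorname{Spec}\mathcal{O}$, $D=\mathbf{V}(y)$ and $P=\mathbf{V}(x,y)$. Call two curves $\mathbf{V}(E),\mathbf{V}(F)\subset S$ equivalent if some $K$-automorphism of $S$ preserving $D$ maps one to the other. For $0\neq F\in\mathcal{O}$ reduced and not divisible by $y$ define the following. - $I^{\mathrm{ea}}_{D,P}(F)$ is the ideal generated by $F$ and all $\delta F$, where $\delta$ is a $K$-derivation of $\mathcal{O}$ with $\delta\langle y\rangle\subseteq\langle y\rangle$ and $\delta\langle x,y\rangle\subseteq\langle x,y\rangle$; put $I^{\mathrm{ea}}_{\log}(F)=I^{\mathrm{ea}}_{D,P}(F):\langle y\rangle$ and $\tau_{\log}(F)=\dim_K\mathcal{O}/I^{\mathrm{ea}}_{\log}(F)$. - $I^{\mathrm{es}}_{D}(F)$ is the set of $g\in\mathcal{O}$ such that $\mathbf{V}(y(F+\epsilon g))$ is an equisingular deformation of $\mathbf{V}(yF)$ over $K[\epsilon]$, $\epsilon^2=0$; put $I^{\mathrm{es}}_{\log}(F)=I^{\mathrm{es}}_{D}(F):\langle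 y\rangle$ and $\tau^{\mathrm{es}}_{\log}(F)=\dim_K\mathcal{O}/I^{\mathrm{es}}_{\log}(F)$. Here a deformation $\mathcal{C}$ of a reduced plane curve germ $C$ over a local artinian $K$-algebra with residue field $K$ is equisingular if it is so along some section $\mathcal{P}\subset\mathcal{C}$. Equisingularity along $\mathcal{P}$ is defined inductively: it always holds if $C$ is smooth; if $C$ is a node, it means that $\mathcal{C}$ is equimultiple along $\mathcal{P}$; otherwise it means that $\mathcal{C}$ is equimultiple along $\mathcal{P}$ and that the reduced total transform of $\mathcal{C}$ on the blow-up of the ambient surface along $\mathcal{P}$ is, at each closed point over $P$, equisingular along some section lying over $\mathcal{P}$. The invariants $\tau_{\log}$ and $\tau^{\mathrm{es}}_{\log}$ of a curve are those of any defining equation. **Proposition.** Let $k\ge 1$ and let $C=\mathbf{V}(E)\subset S$ be an $A_{2k-1}$-singularity, i.e. $C$ is isomorphic to $\mathbf{V}(y^2+x^{2k})$ as a scheme over $K$. Assume that $w:=C.D=\dim_K\mathcal{O}/\langle E,y\rangle$ is finite and $w>2k$. Then $C$ is equivalent to $\mathbf{V}(F)$ with $F=(y+x^k)(y+x^{w-k})$.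 Moreover $$I^{\mathrm{ea}}_{\log}(F)=I^{\mathrm{es}}_{\log}(F)=\langle y,x^k\rangle,$$ and $\tau_{\log}(C)=\tau^{\mathrm{es}}_{\log}(C)=k$. -/

import Mathlib

open MvPowerSeries

namespace LogCurve

/-- Formal power series in two variables over `R`. The variable `X 0` is `x`, `X 1` is `y`.
The formal smooth surface is `S = Spec K[[x, y]]`, its closed point is `P = V(x, y)`, the boundary
divisor is `D = V(y)`, and a series `F` defines the algebroid curve `C = V(F)`. -/
abbrev Ser (R : Type*) := MvPowerSeries (Fin 2) R

section Curve

variable {K : Type*} [Field K]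

/-- The ideal of `D = V(y)`. -/
noncomputable def idealD (K : Type*) [Field K] : Ideal (Ser K) := Ideal.span {X 1}

/-- The ideal of the closed point `P = V(x, y)`. -/
noncomputable def idealP (K : Type*) [Field K] : Ideal (Ser K) := Ideal.span {X 0, X 1}

/-- `V(F)` is an `A_{2k-1}`-singularity: it is isomorphic, as a scheme over `K`,
to `V(y² + x^{2k})`. -/
def IsAOdd (k : ℕ) (F : Ser K) : Prop :=
  Nonempty ((Ser K ⧸ Ideal.span {F}) ≃ₐ[K]
    (Ser K ⧸ Ideal.span {(X 1 ^ 2 + X 0 ^ (2 * k) : Ser K)}))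

/-- The intersection number `V(F).D = dim_K K[[x, y]] / ⟨F, y⟩`
(meaningful when `V(F)` does not contain `D`; otherwise the value of `finrank` is `0`). -/
noncomputable def interD (F : Ser K) : ℕ :=
  Module.finrank K (Ser K ⧸ (Ideal.span {F} ⊔ idealD K))

/-- `V(F)` and `V(G)` are equivalent: some automorphism of `S` over `K` preserves `D`
(hence also `P`) and maps one curve to the other. -/
def Equivalent (F G : Ser K) : Prop :=
  ∃ φ : Ser K ≃ₐ[K] Ser K,
    (idealD K).map φ = idealD K ∧ (Ideal.span {F}).map φ = Ideal.span {G}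

/-- The module of `K`-derivations of `K[[x, y]]` that preserve `D` and `P`. -/
noncomputable def derDP (K : Type*) [Field K] : Submodule (Ser K) (Derivation K (Ser K) (Ser K)) where
  carrier := {δ | (∀ h ∈ idealD K, δ h ∈ idealD K) ∧ (∀ h ∈ idealP K, δ h ∈ idealP K)}
  add_mem' ha hb := ⟨fun h hh => Ideal.add_mem _ (ha.1 h hh) (hb.1 h hh),
    fun h hh => Ideal.add_mem _ (ha.2 h hh) (hb.2 h hh)⟩
  zero_mem' := ⟨fun _ _ => Ideal.zero_mem _, fun _ _ => Ideal.zero_mem _⟩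
  smul_mem' c _ ha := ⟨fun h hh => Ideal.mul_mem_left _ c (ha.1 h hh),
    fun h hh => Ideal.mul_mem_left _ c (ha.2 h hh)⟩

/-- The equianalytic ideal relative to `D` and `P`: all `δ F` with `δ` a derivation preserving `D`
and `P`, together with `F`. -/
noncomputable def ieaRel (F : Ser K) : Ideal (Ser K) :=
  Ideal.span {g | ∃ δ ∈ derDP K, g = δ F} ⊔ Ideal.span {F}

/-- The logarithmic equianalytic ideal: the ideal quotient of `ieaRel F` by the ideal of `D`. -/
noncomputable def ieaLog (F : Ser K) : Ideal (Ser K) := (ieaRel F).colon (idealD K : Set (Ser K))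

/-- `τ_log = dim_K K[[x, y]] / I^ea_log`. -/
noncomputable def tauLog (F : Ser K) : ℕ := Module.finrank K (Ser K ⧸ ieaLog F)

/-- The curve `V(F)` has a node at `P`: `F` lies in the square of the maximal ideal and its
quadratic part is nondegenerate. -/
def IsNode (F : Ser K) : Prop :=
  F.order = 2 ∧
    coeff (Finsupp.single 0 1 + Finsupp.single 1 1) F ^ 2 -
      4 * coeff (Finsupp.single 0 2) F * coeff (Finsupp.single 1 2) F ≠ 0

end Curve

section Equisingular

variable {K : Type*} [Field K] {A : Type*} [CommRing A] [Algebra K A]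

/-- The ideal of the section `V(x - a, y - b)`. -/
noncomputable def idealSec (a b : A) : Ideal (Ser A) := Ideal.span {X 0 - C a, X 1 - C b}

/-- Pull-back of `F` to the point with direction `[1 : c]` of the exceptional curve of the blow-up
along the section `(a, b)`, in the coordinates `x = a + x₁`, `y = b + x₁ (c + y₁)`; the
exceptional curve is `x₁ = 0`. -/
noncomputable def pullChart (a b : A) (c : K) (F : Ser A) : Ser A :=
  subst ![(C a + X 0 : Ser A), C b + X 0 * (C (algebraMap K A c) + X 1)] F

/-- Pull-back of `F` to the point with direction `[0 : 1]` of the exceptional curve of the blow-up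
along the section `(a, b)`, in the coordinates `x = a + x₁ y₁`, `y = b + y₁`; the
exceptional curve is `y₁ = 0`. -/
noncomputable def pullInfty (a b : A) (F : Ser A) : Ser A :=
  subst ![(C a + X 0 * X 1 : Ser A), C b + X 1] F

/-- Let `A` be a local artinian `K`-algebra with residue map `π : A → K`.
`EquisingularAlong π F a b` says that the deformation `V(F) ⊂ Spec A[[x, y]]` of its closed fibre is
equisingular along the section `V(x - a, y - b)` contained in it, where `a`, `b` lie in the maximal
ideal of `A`.

* If the closed fibre is smooth, there is no further condition.
* If it is a node, the condition is equimultiplicity along the section.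
* Otherwise, `V(F)` is equimultiple along the section, and the reduced total transform
  on the blow-up along the section (exceptional curve plus proper transform `G`) is
  equisingular at each closed point of the exceptional curve, along some section that lies over
  the given one. Those sections are exactly the sections of the exceptional curve. -/
inductive EquisingularAlong (π : A →ₐ[K] K) : Ser A → A → A → Prop
  | smooth {F : Ser A} {a b : A} (ha : π a = 0) (hb : π b = 0)
      (hF : (map (π : A →+* K) F).order = 1) (hsec : F ∈ idealSec a b) :
      EquisingularAlong π F a b
  | node {F : Ser A} {a b : A} (ha : π a = 0) (hb : π b = 0)
      (hF : IsNode (map (π : A →+* K) F)) (hmult : F ∈ idealSec a b ^ 2) :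
      EquisingularAlong π F a b
  | blowup {F : Ser A} {a b : A} (ha : π a = 0) (hb : π b = 0) (m : ℕ) (hm : 2 ≤ m)
      (hF : (map (π : A →+* K) F).order = m) (hnode : ¬ IsNode (map (π : A →+* K) F))
      (hmult : F ∈ idealSec a b ^ m)
      (G : K → Ser A) (β : K → A)
      (hG : ∀ c, X 0 ^ m * G c = pullChart a b c F)
      (hes : ∀ c, EquisingularAlong π (X 0 * G c) 0 (β c))
      (G' : Ser A) (β' : A)
      (hG' : X 1 ^ m * G' = pullInfty a b F)
      (hes' : EquisingularAlong π (X 1 * G') β' 0) :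
      EquisingularAlong π F a b

/-- The deformation `V(F)` is equisingular (along some section). -/
def Equisingular (π : A →ₐ[K] K) (F : Ser A) : Prop := ∃ a b : A, EquisingularAlong π F a b

end Equisingular

section EquisingularIdeals

variable {K : Type*} [Field K]

/-- The first order deformation `F + ε g` over the dual numbers `K[ε]`. -/
noncomputable def firstOrder (F g : Ser K) : Ser (DualNumber K) :=
  map (algebraMap K (DualNumber K)) F +
    C (DualNumber.eps : DualNumber K) * map (algebraMap K (DualNumber K)) g

/-- The equisingular ideal relative to `D`, as a set: all `g` such that `V(F + ε g) ∪ D_{K[ε]}`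
is equisingular over `K[ε]`. -/
def iesRel (F : Ser K) : Set (Ser K) :=
  {g | Equisingular (TrivSqZeroExt.fstHom K K K) (X 1 * firstOrder F g)}

/-- The logarithmic equisingular ideal, as a set: the quotient of `iesRel F` by the ideal of `D`. -/
def iesLog (F : Ser K) : Set (Ser K) := {g | ∀ h ∈ idealD K, g * h ∈ iesRel F}

/-- `τ^es_log = dim_K K[[x, y]] / I^es_log`. Since `I^es_log` is given as a set, the quotient is
taken by its `K`-linear span, which is the set itself as soon as it is an ideal. -/
noncomputable def tauEsLog (F : Ser K) : ℕ :=
  Module.finrank K (Ser K ⧸ Submodule.span K (iesLog F))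

end EquisingularIdeals

end LogCurve

/-!
Put `n = w - k`, so that `k < n`, and expand series in powers of `y` with coefficients in `K[[x]]`
(`yCoeff`).

*Normal form.* An isomorphism of `C` with `V(y² + x^{2k})` transports the two branches of the latter
to two surjections `K[[x, y]] → K[[t]]` with contact `k` (`IsAOdd.exists_branchPair`). After a generic
shear `x ↦ x + c y`, which preserves `D`, the series `x` is a local parameter on both branches. They
are then graphs `y = q₁(x)` and `y = q₂(x)`, since homomorphisms between power series rings are
continuous (`algHom_inX`). The orders of `q₁` and `q₂` add up to `w`, and the order of `q₁ - q₂` is `k`;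
so `w > 2k` forces the orders to be `k` and `w - k`, and
`E = (y + β x ^ n) (y + v x ^ k)` up to a unit (`IsAOdd.exists_sheared_eq`). A substitution
`x ↦ x α(x)`, `y ↦ y b(x)` removes the units `β` and `v`: one needs `α ^ (n - k) = β / v`, which has a
solution because `K` is algebraically closed of characteristic zero (`equivalent_normalForm`).

*The equianalytic ideal.* Every derivation preserving `D` and `P` maps `F` into `⟨y², x ^ k⟩`.
Conversely `F` and its images under `x ∂/∂x` and `y ∂/∂y` are combinations of `y²`, `y x ^ k` and
`x ^ (k + n)` with a coefficient matrix that gives `y²` and `y x ^ k` (`ieaLog_eq`). The number `τ_log`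
is invariant under equivalence, by conjugation of derivations (`Equivalent.tauLog_eq`).

*The equisingular ideal.* It is computed for every `E` for which `yE` has the Newton polygon of the
normal form (`BranchType`); this includes `F` and the given `E`, because the polygon
survives a shear (`branchType_sheared`). So no invariance of equisingularity under coordinate
changes is needed. Deformations of `yE` inside the ideal `⟨y, x ^ n⟩² ⟨y, x ^ k⟩` are
equisingular along the trivial section, by blowing up until the branches are separated
(`EquisingularAlong.of_newtonDvd_of_pos`). Conversely, following an equisingular deformation
through the successive blow-ups at the infinitely near triple and double points gives a translation
`y ↦ y + ε s(x)` that brings it into this ideal (`exists_translation`). For a deformation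
`y (E + ε y g)` the vanishing of the coefficient of `y ^ 0` forces `ε s` to vanish to order `n`, the
coefficient of `y` then forces the section to be trivial in the direction of `x`, and the
coefficient of `y²` says that `x ^ k` divides `g(x, 0)` (`X_pow_dvd_of_equisingular`).
-/

namespace LogCurve

/-! ### Power series in two variables as power series in `y` -/

section Expansion

variable {R : Type*} [CommRing R]

/-- A power series in one variable, viewed as a series in `x` alone. -/
noncomputable abbrev inX (p : PowerSeries R) : Ser R := p.toMvPowerSeries 0

/-- The coefficient of `y ^ j`, as a power series in `x`. -/
noncomputable def yCoeff (j : ℕ) : Ser R →ₗ[R] PowerSeries R where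
  toFun f := PowerSeries.mk fun i => coeff (Finsupp.single 0 i + Finsupp.single 1 j) f
  map_add' f g := by ext; simp
  map_smul' c f := by ext; simp

/-- The tail of a series in `y`: drop the part constant in `y` and divide by `y`. -/
noncomputable def yShift (f : Ser R) : Ser R := fun n => coeff (n + Finsupp.single 1 1) f

lemma coeff_yCoeff (i j : ℕ) (f : Ser R) :
    PowerSeries.coeff i (yCoeff j f) = coeff (Finsupp.single 0 i + Finsupp.single 1 j) f := by
  simp [yCoeff]

lemma eq_single_add_single (n : Fin 2 →₀ ℕ) :
    n = Finsupp.single 0 (n 0) + Finsupp.single 1 (n 1) := by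
  ext i; fin_cases i <;> simp

lemma coeff_eq_coeff_yCoeff (n : Fin 2 →₀ ℕ) (f : Ser R) :
    coeff n f = PowerSeries.coeff (n 0) (yCoeff (n 1) f) := by
  rw [coeff_yCoeff, ← eq_single_add_single]

lemma ext_yCoeff {f g : Ser R} (h : ∀ j, yCoeff j f = yCoeff j g) : f = g := by
  ext n; rw [coeff_eq_coeff_yCoeff, coeff_eq_coeff_yCoeff, h]

lemma coeff_inX (n : Fin 2 →₀ ℕ) (p : PowerSeries R) :
    coeff n (inX p) = if n 1 = 0 then PowerSeries.coeff (n 0) p else 0 := by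
  rw [inX, PowerSeries.toMvPowerSeries_eq_subst, PowerSeries.coeff_subst_single]
  refine if_congr ?_ rfl rfl
  constructor
  · intro h; rw [h]; simp
  · intro h; ext i; fin_cases i <;> simp [h]

lemma yCoeff_zero_inX (p : PowerSeries R) : yCoeff 0 (inX p) = p := by
  ext i; simp [coeff_yCoeff, coeff_inX]

lemma yCoeff_yShift (j : ℕ) (f : Ser R) : yCoeff j (yShift f) = yCoeff (j + 1) f := by
  ext i
  rw [coeff_yCoeff, coeff_yCoeff, Finsupp.single_add, ← add_assoc]; rfl

lemma coeff_add_single_X_mul (n : Fin 2 →₀ ℕ) (s : Fin 2) (f : Ser R) :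
    coeff (n + Finsupp.single s 1) (X s * f) = coeff n f := by
  rw [add_comm n, X_def, coeff_add_monomial_mul, one_mul]

lemma coeff_X_mul_of_eq_zero (n : Fin 2 →₀ ℕ) (s : Fin 2) (f : Ser R) (h : n s = 0) :
    coeff n (X s * f) = 0 :=
  X_dvd_iff.mp (dvd_mul_right _ _) n h

lemma yCoeff_zero_X_one_mul (f : Ser R) : yCoeff 0 (X 1 * f) = 0 := by
  ext i; rw [coeff_yCoeff, coeff_X_mul_of_eq_zero _ _ _ (by simp), map_zero]

lemma yCoeff_succ_X_one_mul (j : ℕ) (f : Ser R) : yCoeff (j + 1) (X 1 * f) = yCoeff j f := by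
  ext i
  rw [coeff_yCoeff, coeff_yCoeff, Finsupp.single_add, ← add_assoc, coeff_add_single_X_mul]

lemma yCoeff_X_zero_mul (j : ℕ) (f : Ser R) :
    yCoeff j (X 0 * f) = PowerSeries.X * yCoeff j f := by
  ext i
  rcases i with _ | i
  · rw [coeff_yCoeff, coeff_X_mul_of_eq_zero _ _ _ (by simp), PowerSeries.coeff_zero_X_mul]
  · rw [coeff_yCoeff, PowerSeries.coeff_succ_X_mul, coeff_yCoeff, Finsupp.single_add, add_right_comm,
      coeff_add_single_X_mul]

lemma yCoeff_X_zero_pow_mul (j m : ℕ) (f : Ser R) :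
    yCoeff j (X 0 ^ m * f) = PowerSeries.X ^ m * yCoeff j f := by
  induction m with
  | zero => simp
  | succ m ih => rw [pow_succ', mul_assoc, yCoeff_X_zero_mul, ih, pow_succ', mul_assoc]

lemma yCoeff_C_mul (j : ℕ) (a : R) (f : Ser R) :
    yCoeff j (C a * f) = PowerSeries.C a * yCoeff j f := by
  rw [← smul_eq_C_mul, map_smul, PowerSeries.smul_eq_C_mul]

lemma yCoeff_X_one_pow_mul_of_lt {j m : ℕ} (h : j < m) (f : Ser R) :
    yCoeff j (X 1 ^ m * f) = 0 := by
  induction m generalizing j with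
  | zero => omega
  | succ m ih =>
    rw [pow_succ', mul_assoc]
    rcases j with _ | j
    · exact yCoeff_zero_X_one_mul _
    · rw [yCoeff_succ_X_one_mul, ih (by omega)]

lemma yCoeff_X_one_pow_mul_add (j m : ℕ) (f : Ser R) :
    yCoeff (j + m) (X 1 ^ m * f) = yCoeff j f := by
  induction m with
  | zero => simp
  | succ m ih => rw [pow_succ', mul_assoc, ← add_assoc, yCoeff_succ_X_one_mul, ih]

lemma yCoeff_zero_add_yShift (f : Ser R) : f = inX (yCoeff 0 f) + X 1 * yShift f := by
  apply ext_yCoeff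
  intro j
  rw [map_add]
  rcases j with _ | j
  · rw [yCoeff_zero_X_one_mul, yCoeff_zero_inX, add_zero]
  · rw [yCoeff_succ_X_one_mul, yCoeff_yShift]
    ext i; simp [coeff_yCoeff, coeff_inX]

/-- A family of series, each of which is `X` times another member of the family, vanishes. This is
used in place of continuity: `i'` is obtained from `i` by dropping the constant term of a series. -/
lemma eq_zero_of_forall_X_dvd {ι : Type*} (d : ι → PowerSeries R)
    (h : ∀ i, ∃ i', d i = PowerSeries.X * d i') (i : ι) : d i = 0 := by
  have key : ∀ (N : ℕ) i, PowerSeries.X ^ N ∣ d i := by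
    intro N
    induction N with
    | zero => simp
    | succ N ih =>
      intro i
      obtain ⟨i', hi⟩ := h i
      rw [hi, pow_succ']
      exact mul_dvd_mul_left _ (ih i')
  ext n
  exact PowerSeries.X_pow_dvd_iff.mp (key (n + 1) i) n (by omega)

lemma exists_eq_C_add_X_mul (p : PowerSeries R) :
    ∃ c q, p = PowerSeries.C c + PowerSeries.X * q :=
  ⟨_, _, by rw [add_comm]; exact p.eq_X_mul_shift_add_const⟩

lemma yCoeff_inX_mul (j : ℕ) (p : PowerSeries R) (f : Ser R) :
    yCoeff j (inX p * f) = p * yCoeff j f := by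
  rw [← sub_eq_zero]
  refine eq_zero_of_forall_X_dvd (fun p => yCoeff j (inX p * f) - p * yCoeff j f) (fun p => ?_) p
  obtain ⟨c, q, rfl⟩ := exists_eq_C_add_X_mul p
  refine ⟨q, ?_⟩
  simp only [inX, map_add, map_mul, PowerSeries.toMvPowerSeries_C, PowerSeries.toMvPowerSeries_X,
    add_mul, yCoeff_C_mul, mul_assoc, yCoeff_X_zero_mul]
  ring

lemma yCoeff_inX_succ (j : ℕ) (p : PowerSeries R) : yCoeff (j + 1) (inX p) = 0 := by
  ext i; simp [coeff_yCoeff, coeff_inX]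

lemma constantCoeff_eq_yCoeff (f : Ser R) :
    constantCoeff f = PowerSeries.constantCoeff (yCoeff 0 f) := by
  rw [← PowerSeries.coeff_zero_eq_constantCoeff_apply, coeff_yCoeff]; simp

lemma constantCoeff_inX (p : PowerSeries R) :
    constantCoeff (inX p) = PowerSeries.constantCoeff p := by
  rw [constantCoeff_eq_yCoeff, yCoeff_zero_inX]

/-- The expansion of a series in powers of `y`, with remainder. -/
lemma eq_sum_add_iterate_yShift (N : ℕ) (f : Ser R) :
    f = ∑ j ∈ Finset.range N, inX (yCoeff j f) * X 1 ^ j + X 1 ^ N * yShift^[N] f := by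
  induction N generalizing f with
  | zero => simp
  | succ N ih =>
    rw [Finset.sum_range_succ', Function.iterate_succ_apply]
    conv_lhs => rw [yCoeff_zero_add_yShift f, ih (yShift f)]
    simp only [yCoeff_yShift, mul_add, Finset.mul_sum, pow_succ]
    ring_nf

lemma yCoeff_map {S : Type*} [CommRing S] (φ : R →+* S) (j : ℕ) (f : Ser R) :
    yCoeff j (map φ f) = PowerSeries.map φ (yCoeff j f) := by
  ext i; simp [coeff_yCoeff]

lemma coeff_single_eq_pderiv (s : Fin 2) (f : Ser R) :
    coeff (Finsupp.single s 1) f = constantCoeff (pderiv R s f) := by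
  rw [← coeff_zero_eq_constantCoeff_apply, coeff_pderiv]; simp

/-- The product rule for the linear coefficients. -/
lemma coeff_single_mul (s : Fin 2) (f g : Ser R) :
    coeff (Finsupp.single s 1) (f * g) =
      constantCoeff f * coeff (Finsupp.single s 1) g +
        constantCoeff g * coeff (Finsupp.single s 1) f := by
  simp [coeff_single_eq_pderiv]

section Subst

variable {u v : Ser R}

lemma hasSubst_pair (hu : IsNilpotent (constantCoeff u)) (hv : IsNilpotent (constantCoeff v)) :
    HasSubst ![u, v] :=
  hasSubst_of_constantCoeff_nilpotent fun s => by fin_cases s <;> simpa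

lemma subst_X_zero (h : HasSubst ![u, v]) : subst ![u, v] (X 0 : Ser R) = u := by
  simp [subst_X h]

lemma subst_X_one (h : HasSubst ![u, v]) : subst ![u, v] (X 1 : Ser R) = v := by
  simp [subst_X h]

lemma subst_inX (h : HasSubst ![u, v]) (p : PowerSeries R) :
    subst ![u, v] (inX p) = p.subst u := by
  rw [inX, PowerSeries.subst_toMvPowerSeries h]; rfl

/-- Substitution applied to the expansion in powers of `y`. -/
lemma subst_eq_sum_add (h : HasSubst ![u, v]) (N : ℕ) (f : Ser R) :
    subst ![u, v] f = ∑ j ∈ Finset.range N, (yCoeff j f).subst u * v ^ j +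
      v ^ N * subst ![u, v] (yShift^[N] f) := by
  conv_lhs => rw [eq_sum_add_iterate_yShift N f]
  rw [← coe_substAlgHom h]
  simp only [map_add, map_sum, map_mul, map_pow, coe_substAlgHom h, subst_X_one h, subst_inX h]

end Subst

end Expansion

/-! ### Charts of a blow-up in terms of the coefficients in `y` -/

section Charts

variable {A : Type*} [CommRing A]

/-- First order Taylor expansion along a translation of square zero. -/
lemma subst_C_add_X_zero {a : A} (ha : a * a = 0) (p : PowerSeries A) :
    p.subst (C a + X 0 : Ser A) = inX (p + PowerSeries.C a * PowerSeries.derivative A p) := by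
  have hu : PowerSeries.HasSubst (C a + X 0 : Ser A) := by
    change IsNilpotent (constantCoeff (C a + X 0 : Ser A))
    simpa using ⟨2, by rw [pow_two, ha]⟩
  have hCa : (C a : Ser A) * C a = 0 := by rw [← map_mul, ha, map_zero]
  let D : PowerSeries A → Ser A := fun p =>
    p.subst (C a + X 0 : Ser A) - inX (p + PowerSeries.C a * PowerSeries.derivative A p)
  have hD : ∀ c q, D (PowerSeries.C c + PowerSeries.X * q) = (C a + X 0) * D q := by
    intro c q
    simp only [D, ← PowerSeries.coe_substAlgHom hu, map_add, map_mul]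
    simp only [PowerSeries.coe_substAlgHom hu, PowerSeries.subst_C, PowerSeries.subst_X hu,
      Derivation.leibniz, map_add, map_mul, PowerSeries.toMvPowerSeries_C,
      PowerSeries.toMvPowerSeries_X, PowerSeries.derivative_C, PowerSeries.derivative_X,
      smul_eq_mul, map_zero, map_one]
    linear_combination PowerSeries.toMvPowerSeries 0 (PowerSeries.derivative A q) * hCa
  -- the square of the translated variable is a multiple of the variable
  have hsq : (C a + X 0 : Ser A) * (C a + X 0) = X 0 * (2 * C a + X 0) := by
    linear_combination hCa
  have key : ∀ s : Ser A, ∀ j, yCoeff j (s * D p) = 0 := by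
    intro s j
    refine eq_zero_of_forall_X_dvd (fun i : Ser A × PowerSeries A => yCoeff j (i.1 * D i.2))
      (fun i => ?_) (s, p)
    obtain ⟨s, p⟩ := i
    obtain ⟨c, q, rfl⟩ := exists_eq_C_add_X_mul p
    obtain ⟨c', q, rfl⟩ := exists_eq_C_add_X_mul q
    refine ⟨(s * (2 * C a + X 0), q), ?_⟩
    rw [← yCoeff_X_zero_mul]
    congr 1
    simp only [hD]
    linear_combination s * D q * hsq
  refine sub_eq_zero.mp (ext_yCoeff fun j => ?_)
  have := key 1 j
  rwa [one_mul] at this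

/-- The coefficients of the pull-back to the point `[1 : 0]` of the exceptional curve of the
blow-up along a section that is trivial to first order. -/
lemma yCoeff_pullChart {K : Type*} [Field K] [Algebra K A] {a b : A} (ha : a * a = 0)
    (hb : b * b = 0) (hab : a * b = 0) (H : Ser A) :
    let h' := fun j => yCoeff j H + PowerSeries.C a * PowerSeries.derivative A (yCoeff j H)
    yCoeff 0 (pullChart a b (0 : K) H) = h' 0 + PowerSeries.C b * yCoeff 1 H ∧
    yCoeff 1 (pullChart a b (0 : K) H) =
      PowerSeries.X * (h' 1 + 2 * PowerSeries.C b * yCoeff 2 H) ∧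
    yCoeff 2 (pullChart a b (0 : K) H) =
      PowerSeries.X ^ 2 * (h' 2 + 3 * PowerSeries.C b * yCoeff 3 H) ∧
    ∃ T, yCoeff 3 (pullChart a b (0 : K) H) =
      PowerSeries.X ^ 3 * (h' 3 + PowerSeries.C b * T) := by
  intro h'
  have hs : HasSubst ![(C a + X 0 : Ser A), C b + X 0 * (C (algebraMap K A 0) + X 1)] := by
    refine hasSubst_pair ?_ ?_
    · simpa using ⟨2, by rw [pow_two, ha]⟩
    · simpa using ⟨2, by rw [pow_two, hb]⟩
  have hCb : (C b : Ser A) * C b = 0 := by rw [← map_mul, hb, map_zero]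
  have hCab : PowerSeries.C b * PowerSeries.C a = 0 := by rw [← map_mul, mul_comm, hab, map_zero]
  obtain ⟨T, hT⟩ : ∃ T, T = subst ![(C a + X 0 : Ser A), C b + X 0 * (C (algebraMap K A 0) + X 1)]
    (yShift^[4] H) := ⟨_, rfl⟩
  have hexp : pullChart a b (0 : K) H = inX (h' 0 + PowerSeries.C b * h' 1) +
      X 1 * inX (PowerSeries.X * (h' 1 + 2 * PowerSeries.C b * h' 2)) +
      X 1 ^ 2 * inX (PowerSeries.X ^ 2 * (h' 2 + 3 * PowerSeries.C b * h' 3)) +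
      X 1 ^ 3 * (X 0 ^ 3 * (inX (h' 3) + C b * (4 * T)) + X 1 * (X 0 ^ 4 * T)) := by
    rw [pullChart, subst_eq_sum_add hs 4, ← hT]
    simp only [Finset.sum_range_succ, Finset.sum_range_zero, subst_C_add_X_zero ha, map_zero,
      zero_add]
    change inX (h' 0) * _ + inX (h' 1) * _ + inX (h' 2) * _ + inX (h' 3) * _ + _ = _
    simp only [inX, map_add, map_mul, map_pow, PowerSeries.toMvPowerSeries_C,
      PowerSeries.toMvPowerSeries_X, map_ofNat]
    linear_combination
      (PowerSeries.toMvPowerSeries 0 (h' 2) + PowerSeries.toMvPowerSeries 0 (h' 3) *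
        (C b + 3 * X 0 * X 1) + T * (C b ^ 2 + 4 * C b * X 0 * X 1 + 6 * X 0 ^ 2 * X 1 ^ 2)) * hCb
  have hC : ∀ j, PowerSeries.C b * h' j = PowerSeries.C b * yCoeff j H := by
    intro j
    linear_combination PowerSeries.derivative A (yCoeff j H) * hCab
  have e2 : ∀ f : Ser A, yCoeff 2 (X 1 * f) = yCoeff 1 f := fun f => yCoeff_succ_X_one_mul 1 f
  have e1 : ∀ f : Ser A, yCoeff 1 (X 1 * f) = yCoeff 0 f := fun f => yCoeff_succ_X_one_mul 0 f
  have e3 : ∀ f : Ser A, yCoeff 3 (X 1 * f) = yCoeff 2 f := fun f => yCoeff_succ_X_one_mul 2 f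
  have z1 : ∀ p : PowerSeries A, yCoeff 1 (inX p) = 0 := fun p => yCoeff_inX_succ 0 p
  have z2 : ∀ p : PowerSeries A, yCoeff 2 (inX p) = 0 := fun p => yCoeff_inX_succ 1 p
  have z3 : ∀ p : PowerSeries A, yCoeff 3 (inX p) = 0 := fun p => yCoeff_inX_succ 2 p
  rw [hexp]
  simp only [pow_succ (X 1 : Ser A), pow_zero, one_mul, mul_assoc (X 1 : Ser A)]
  refine ⟨?_, ?_, ?_, yCoeff 0 (4 * T), ?_⟩
  · simp only [map_add, yCoeff_zero_X_one_mul, yCoeff_zero_inX]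
    rw [hC]; ring
  · simp only [map_add, e1, z1, yCoeff_zero_X_one_mul, yCoeff_zero_inX]
    linear_combination 2 * PowerSeries.X * hC 2
  · simp only [map_add, e1, e2, z1, z2, yCoeff_zero_X_one_mul, yCoeff_zero_inX]
    linear_combination 3 * PowerSeries.X ^ 2 * hC 3
  · simp only [map_add, e1, e2, e3, z1, z2, z3, yCoeff_zero_X_one_mul, yCoeff_X_zero_pow_mul,
      yCoeff_zero_inX, yCoeff_C_mul]
    ring

end Charts

/-! ### Curves with a prescribed contact of their branches -/

section BranchType

variable {K : Type*} [Field K]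

/-- The coefficients of `y * (A y² + B y x ^ k + C x ^ (k + n))` with `B` and `C` units, and with
`A` a unit as well if `k ≥ 2`. For `1 ≤ k < n` such a series defines three smooth branches: `y = 0`,
a branch that has contact `n` with it, and a third one that has contact `k` with these two.
For `k = 0 < n` only the first two branches remain. -/
structure BranchType (k n : ℕ) (Q : Ser K) : Prop where
  zero : yCoeff 0 Q = 0
  one : ∃ u, PowerSeries.constantCoeff u ≠ 0 ∧ yCoeff 1 Q = PowerSeries.X ^ (k + n) * u
  two : ∃ v, PowerSeries.constantCoeff v ≠ 0 ∧ yCoeff 2 Q = PowerSeries.X ^ k * v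
  three : 2 ≤ k → PowerSeries.constantCoeff (yCoeff 3 Q) ≠ 0

/-- The number of branches of a curve of type `BranchType k n`, which is its multiplicity. -/
def branchMult (k : ℕ) : ℕ := if k = 0 then 2 else 3

lemma degree_fin_two (d : Fin 2 →₀ ℕ) : Finsupp.degree d = d 0 + d 1 := by
  rw [Finsupp.degree_eq_sum, Fin.sum_univ_two]

lemma BranchType.order_eq {k n : ℕ} {Q : Ser K} (h : BranchType k n Q) (hkn : k ≤ n)
    (hn : 1 ≤ n) : Q.order = branchMult k := by
  obtain ⟨u, hu, h1⟩ := h.one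
  obtain ⟨v, hv, h2⟩ := h.two
  rw [order_eq_nat]
  constructor
  · have hcoeff : ∀ i j, PowerSeries.coeff i (yCoeff j Q) ≠ 0 → i + j = branchMult k →
        ∃ d, coeff d Q ≠ 0 ∧ Finsupp.degree d = branchMult k := by
      intro i j hij hm
      refine ⟨Finsupp.single 0 i + Finsupp.single 1 j, by rwa [← coeff_yCoeff], ?_⟩
      rw [degree_fin_two]; simpa using hm
    have h2' : PowerSeries.coeff k (yCoeff 2 Q) ≠ 0 := by
      rw [h2, PowerSeries.coeff_X_pow_mul']; simpa using hv
    rcases k with _ | _ | k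
    · exact hcoeff 0 2 h2' rfl
    · exact hcoeff 1 2 h2' rfl
    · exact hcoeff 0 3 (by simpa using h.three (by omega)) rfl
  · intro d hd
    rw [degree_fin_two] at hd
    have hm : branchMult k ≤ k + 2 ∧ branchMult k ≤ 3 := by
      unfold branchMult; split_ifs <;> omega
    rw [coeff_eq_coeff_yCoeff]
    rcases hd1 : d 1 with _ | _ | _ | j
    · rw [h.zero, map_zero]
    · rw [zero_add, h1, PowerSeries.coeff_X_pow_mul', if_neg (by omega)]
    · rw [h2, PowerSeries.coeff_X_pow_mul', if_neg (by omega)]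
    · omega

end BranchType

/-! ### Equisingular first order deformations: necessary conditions -/

section Necessary

variable {K : Type*} [Field K]

local notation "π" => TrivSqZeroExt.fstHom K K K

lemma mul_eq_zero_of_fst_eq_zero {a b : DualNumber K} (ha : π a = 0) (hb : π b = 0) :
    a * b = 0 := by
  ext
  · simp only [TrivSqZeroExt.fstHom_apply] at ha; simp [ha]
  · simp only [TrivSqZeroExt.fstHom_apply] at ha hb; simp [ha, hb]

lemma exists_eq_eps_mul {a : DualNumber K} (ha : π a = 0) : ∃ r, a = DualNumber.eps * r := by
  simp only [TrivSqZeroExt.fstHom_apply] at ha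
  exact ⟨TrivSqZeroExt.inl a.snd, by ext <;> simp [ha]⟩

lemma order_X (s : Fin 2) : (X s : Ser K).order = 1 := by
  classical
  rw [X_def, order_monomial_of_ne_zero one_ne_zero]; simp

/-- A deformation of a curve of multiplicity at least three can only be equisingular by the
blow-up clause. -/
lemma EquisingularAlong.exists_chart_zero {F : Ser (DualNumber K)} {a b : DualNumber K}
    (h : EquisingularAlong π F a b) {m : ℕ} (hm : 3 ≤ m)
    (hF : (map (π : DualNumber K →+* K) F).order = m) :
    π a = 0 ∧ π b = 0 ∧ ∃ G β, X 0 ^ m * G = pullChart a b (0 : K) F ∧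
      EquisingularAlong π (X 0 * G) 0 β := by
  cases h with
  | smooth ha hb hF' hsec =>
    rw [hF'] at hF
    have : (1 : ℕ) = m := by exact_mod_cast hF
    omega
  | node ha hb hF' hmult =>
    rw [hF'.1] at hF
    have : (2 : ℕ) = m := by exact_mod_cast hF
    omega
  | blowup ha hb m' hm' hF' hnode hmult G β hG hes G' β' hG' hes' =>
    rw [hF'] at hF
    obtain rfl : m' = m := by exact_mod_cast hF
    exact ⟨ha, hb, G 0, β 0, hG 0, hes 0⟩

/-- The coefficients of the strict transform at `[1 : 0]` again have the shape of `BranchType`. -/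
lemma BranchType.of_blowup {k n m : ℕ} {Q G : Ser K} (h : BranchType k n Q) (hm : m = branchMult k)
    (hn : 1 ≤ n)
    (hG : ∀ j ≤ m, PowerSeries.X ^ m * yCoeff j G = PowerSeries.X ^ j * yCoeff j Q) :
    BranchType (k - 1) (n - 1) G := by
  obtain ⟨u, hu, h1⟩ := h.one
  obtain ⟨v, hv, h2⟩ := h.two
  have hm2 : 2 ≤ m := by rw [hm]; unfold branchMult; split_ifs <;> omega
  refine ⟨?_, ⟨u, hu, ?_⟩, ⟨v, hv, ?_⟩, ?_⟩
  · apply PowerSeries.X_pow_mul_cancel (k := m)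
    rw [hG 0 (by omega), h.zero, mul_zero, mul_zero]
  · apply PowerSeries.X_pow_mul_cancel (k := m)
    rw [hG 1 (by omega), h1, ← mul_assoc, ← mul_assoc, ← pow_add, ← pow_add]
    congr 2
    unfold branchMult at hm; split_ifs at hm <;> omega
  · apply PowerSeries.X_pow_mul_cancel (k := m)
    rw [hG 2 (by omega), h2, ← mul_assoc, ← mul_assoc, ← pow_add, ← pow_add]
    congr 2
    unfold branchMult at hm; split_ifs at hm <;> omega
  · intro hk
    obtain rfl : m = 3 := by rw [hm, branchMult, if_neg (by omega)]
    rw [PowerSeries.X_pow_mul_cancel (hG 3 (by omega))]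
    exact h.three (by omega)

/-- The inductive step of `exists_translation`: a translation `s'` that works for the strict
transform `G` along the section `(a, b)` gives the translation `b + x * s'`. -/
lemma exists_translation_step {k n m : ℕ} {H G : Ser (DualNumber K)} {a b : DualNumber K}
    (ha : π a = 0) (hb : π b = 0) (hm : m = branchMult k) (hn : 1 ≤ n)
    (hQ : BranchType k n (map (π : DualNumber K →+* K) H))
    (hG : X 0 ^ m * G = pullChart a b (0 : K) H)
    (ih : BranchType (k - 1) (n - 1) (map (π : DualNumber K →+* K) G) →
      ∃ s, PowerSeries.X ^ (k - 1 + 2 * (n - 1)) ∣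
          yCoeff 0 G + PowerSeries.C DualNumber.eps * s * yCoeff 1 G ∧
        PowerSeries.X ^ (k - 1 + (n - 1)) ∣
          yCoeff 1 G + 2 * (PowerSeries.C DualNumber.eps * s) * yCoeff 2 G ∧
        PowerSeries.X ^ (k - 1) ∣
          yCoeff 2 G + 3 * (PowerSeries.C DualNumber.eps * s) * yCoeff 3 G) :
    ∃ s, PowerSeries.X ^ (k + 2 * n) ∣ yCoeff 0 H +
          PowerSeries.C a * PowerSeries.derivative (DualNumber K) (yCoeff 0 H) +
          PowerSeries.C DualNumber.eps * s * yCoeff 1 H ∧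
        PowerSeries.X ^ (k + n) ∣ yCoeff 1 H +
          PowerSeries.C a * PowerSeries.derivative (DualNumber K) (yCoeff 1 H) +
          2 * (PowerSeries.C DualNumber.eps * s) * yCoeff 2 H ∧
        PowerSeries.X ^ k ∣ yCoeff 2 H +
          PowerSeries.C a * PowerSeries.derivative (DualNumber K) (yCoeff 2 H) +
          3 * (PowerSeries.C DualNumber.eps * s) * yCoeff 3 H := by
  obtain ⟨c0, c1, c2, T, c3⟩ := yCoeff_pullChart (K := K) (mul_eq_zero_of_fst_eq_zero ha ha)
    (mul_eq_zero_of_fst_eq_zero hb hb) (mul_eq_zero_of_fst_eq_zero ha hb) H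
  rw [← hG, yCoeff_X_zero_pow_mul] at c0 c1 c2 c3
  have hmapC : ∀ c : DualNumber K, π c = 0 →
      PowerSeries.map (π : DualNumber K →+* K) (PowerSeries.C c) = 0 := by
    intro c hc
    rw [PowerSeries.map_C]
    exact (congrArg PowerSeries.C hc).trans (map_zero _)
  have hbt := hQ.of_blowup (G := map (π : DualNumber K →+* K) G) hm hn (by
    intro j hj
    simp only [yCoeff_map]
    have hm3 : m ≤ 3 := by rw [hm]; unfold branchMult; split_ifs <;> omega
    replace hj : j ≤ 3 := hj.trans hm3
    interval_cases j
    · simpa [hmapC a ha, hmapC b hb] using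
        congrArg (PowerSeries.map (π : DualNumber K →+* K)) c0
    · simpa [hmapC a ha, hmapC b hb] using
        congrArg (PowerSeries.map (π : DualNumber K →+* K)) c1
    · simpa [hmapC a ha, hmapC b hb] using
        congrArg (PowerSeries.map (π : DualNumber K →+* K)) c2
    · simpa [hmapC a ha, hmapC b hb] using
        congrArg (PowerSeries.map (π : DualNumber K →+* K)) c3)
  obtain ⟨s, ⟨t0, d0⟩, ⟨t1, d1⟩, ⟨t2, d2⟩⟩ := ih hbt
  obtain ⟨r, rfl⟩ := exists_eq_eps_mul hb
  obtain ⟨q, rfl⟩ := exists_eq_eps_mul ha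
  have hee : PowerSeries.C (DualNumber.eps : DualNumber K) * PowerSeries.C DualNumber.eps = 0 := by
    rw [← map_mul, DualNumber.eps_mul_eps, map_zero]
  simp only [map_mul PowerSeries.C] at c0 c1 c2 c3 ⊢
  generalize PowerSeries.C (DualNumber.eps : DualNumber K) = e at *
  refine ⟨PowerSeries.C r + PowerSeries.X * s, ⟨t0, ?_⟩, ⟨t1, ?_⟩, ?_⟩
  · have hk : k + 2 * n = m + (k - 1 + 2 * (n - 1)) := by
      rw [hm]; unfold branchMult; split_ifs <;> omega
    rw [hk, pow_add]
    linear_combination (-1 : PowerSeries (DualNumber K)) * c0 - e * s * c1 +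
      PowerSeries.X ^ m * d0 -
      (s * PowerSeries.X * (PowerSeries.C q * PowerSeries.derivative _ (yCoeff 1 H) +
        2 * PowerSeries.C r * yCoeff 2 H)) * hee
  · apply PowerSeries.X_mul_cancel
    have hk : k + n + 1 = m + (k - 1 + (n - 1)) := by
      rw [hm]; unfold branchMult; split_ifs <;> omega
    have hp : PowerSeries.X * PowerSeries.X ^ (k + n) =
        (PowerSeries.X ^ m * PowerSeries.X ^ (k - 1 + (n - 1)) : PowerSeries (DualNumber K)) := by
      rw [← pow_succ', hk, pow_add]
    linear_combination (-1 : PowerSeries (DualNumber K)) * c1 - 2 * e * s * c2 +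
      PowerSeries.X ^ m * d1 - t1 * hp -
      (2 * s * PowerSeries.X ^ 2 * (PowerSeries.C q * PowerSeries.derivative _ (yCoeff 2 H) +
        3 * PowerSeries.C r * yCoeff 3 H)) * hee
  · rcases Nat.eq_zero_or_pos k with rfl | hpos
    · simp
    refine ⟨t2, ?_⟩
    apply PowerSeries.X_pow_mul_cancel (k := 2)
    have hk : 2 + k = m + (k - 1) := by
      rw [hm]; unfold branchMult; split_ifs <;> omega
    have hp : PowerSeries.X ^ 2 * PowerSeries.X ^ k =
        (PowerSeries.X ^ m * PowerSeries.X ^ (k - 1) : PowerSeries (DualNumber K)) := by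
      rw [← pow_add, hk, pow_add]
    linear_combination (-1 : PowerSeries (DualNumber K)) * c2 - 3 * e * s * c3 +
      PowerSeries.X ^ m * d2 - t2 * hp -
      (3 * s * PowerSeries.X ^ 3 * (PowerSeries.C q * PowerSeries.derivative _ (yCoeff 3 H) +
        PowerSeries.C r * T)) * hee

/-- If the union of a first order deformation `V(H)` of a curve of type `BranchType k n` and the
exceptional curve `x = 0` is equisingular, then a translation `y ↦ y + ε s(x)` brings `H` into the
monomial ideal `⟨y, x ^ n⟩ ^ 2 * ⟨y, x ^ k⟩` given by the Newton polygon. -/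
lemma exists_translation {n : ℕ} : ∀ {k : ℕ} {H : Ser (DualNumber K)} {b : DualNumber K}, k ≤ n →
    BranchType k n (map (π : DualNumber K →+* K) H) → EquisingularAlong π (X 0 * H) 0 b →
    ∃ s, PowerSeries.X ^ (k + 2 * n) ∣
          yCoeff 0 H + PowerSeries.C DualNumber.eps * s * yCoeff 1 H ∧
        PowerSeries.X ^ (k + n) ∣
          yCoeff 1 H + 2 * (PowerSeries.C DualNumber.eps * s) * yCoeff 2 H ∧
        PowerSeries.X ^ k ∣
          yCoeff 2 H + 3 * (PowerSeries.C DualNumber.eps * s) * yCoeff 3 H := by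
  induction n with
  | zero =>
    intro k H b hk _ _
    obtain rfl : k = 0 := by omega
    exact ⟨0, by simp⟩
  | succ n ih =>
    intro k H b hkn hQ hes
    have hord : (map (π : DualNumber K →+* K) (X 0 * H)).order = (branchMult k + 1 : ℕ) := by
      rw [map_mul, map_X, order_mul, order_X, hQ.order_eq hkn (by omega)]
      push_cast; ring
    obtain ⟨-, hb, G, β, hG, hes'⟩ := hes.exists_chart_zero
      (by unfold branchMult; split_ifs <;> omega) hord
    have hs : HasSubst ![(C 0 + X 0 : Ser (DualNumber K)),
        C b + X 0 * (C (algebraMap K (DualNumber K) 0) + X 1)] := by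
      refine hasSubst_pair (by simp) ?_
      simpa using ⟨2, by rw [pow_two, mul_eq_zero_of_fst_eq_zero hb hb]⟩
    have hG' : X 0 ^ branchMult k * G = pullChart 0 b (0 : K) H := by
      have hX : (X 0 : Ser (DualNumber K)) * (X 0 ^ branchMult k * G) =
          X 0 * pullChart 0 b (0 : K) H := by
        rw [← mul_assoc, ← pow_succ', hG, pullChart, subst_mul hs, subst_X_zero hs, pullChart]
        simp
      exact X_mem_nonzeroDivisors.1 _ (by rw [mul_sub, hX, sub_self]) |> sub_eq_zero.mp
    obtain ⟨s, h0, h1, h2⟩ := exists_translation_step (map_zero _) hb rfl (by omega) hQ hG'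
      (fun hbt => ih (by omega) hbt hes')
    simp only [map_zero, zero_mul, add_zero] at h0 h1 h2
    exact ⟨s, h0, h1, h2⟩

end Necessary

/-! ### Equisingular first order deformations: the ideal is contained in `⟨y, x ^ k⟩` -/

section NecessaryTop

variable {K : Type*} [Field K]

local notation "π" => TrivSqZeroExt.fstHom K K K

lemma fst_algebraMap (c : K) : TrivSqZeroExt.fst (algebraMap K (DualNumber K) c) = c := rfl

lemma fst_comp_algebraMap :
    (π : DualNumber K →+* K).comp (algebraMap K (DualNumber K)) = RingHom.id K := by
  ext; simp

lemma map_firstOrder (F g : Ser K) :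
    map (π : DualNumber K →+* K) (X 1 * firstOrder F g) = X 1 * F := by
  have he : (π : DualNumber K →+* K) DualNumber.eps = 0 := by simp
  rw [map_mul, map_X, firstOrder, map_add, map_mul, map_C, he, map_zero, zero_mul, add_zero,
    map_map, fst_comp_algebraMap, map_id, RingHom.id_apply]

lemma yCoeff_firstOrder (j : ℕ) (F g : Ser K) :
    yCoeff (j + 1) (X 1 * firstOrder F g) =
      PowerSeries.map (algebraMap K (DualNumber K)) (yCoeff j F) +
        PowerSeries.C DualNumber.eps *
          PowerSeries.map (algebraMap K (DualNumber K)) (yCoeff j g) := by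
  rw [yCoeff_succ_X_one_mul, firstOrder, map_add, yCoeff_C_mul, yCoeff_map, yCoeff_map]

/-- `ε` times a series over `K` is divisible by `x ^ m` over `K[ε]` only if the series is. -/
lemma X_pow_dvd_of_eps_mul {m : ℕ} {p : PowerSeries K}
    (h : PowerSeries.X ^ m ∣ PowerSeries.C (DualNumber.eps : DualNumber K) *
      PowerSeries.map (algebraMap K (DualNumber K)) p) : PowerSeries.X ^ m ∣ p := by
  rw [PowerSeries.X_pow_dvd_iff] at h ⊢
  intro i hi
  simpa [fst_algebraMap] using congrArg TrivSqZeroExt.snd (h i hi)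

lemma X_pow_dvd_map {R S : Type*} [CommRing R] [CommRing S] (φ : R →+* S) {m : ℕ}
    {p : PowerSeries R} (h : PowerSeries.X ^ m ∣ p) :
    PowerSeries.X ^ m ∣ PowerSeries.map φ p := by
  simpa using map_dvd (PowerSeries.map φ) h

lemma isUnit_map_of_constantCoeff_ne_zero {R : Type*} [CommRing R] (φ : K →+* R)
    {u : PowerSeries K} (hu : PowerSeries.constantCoeff u ≠ 0) :
    IsUnit (PowerSeries.map φ u) :=
  (PowerSeries.isUnit_iff_constantCoeff.mpr hu.isUnit).map _

/-- A deformation `E + ε y g` whose union with `y = 0` is equisingular satisfies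
`g ∈ ⟨y, x ^ k⟩`. The branch structure forces the section to be trivial in the direction of `x`,
and its translation in the direction of `y` to vanish to order `n`. -/
theorem X_pow_dvd_of_equisingular [CharZero K] {k n : ℕ} (hk : 1 ≤ k) (hkn : k ≤ n) {E g : Ser K}
    (hE : BranchType k n (X 1 * E)) (h : Equisingular π (X 1 * firstOrder E (X 1 * g))) :
    PowerSeries.X ^ k ∣ yCoeff 0 g := by
  obtain ⟨a, b, hes⟩ := h
  set H := X 1 * firstOrder E (X 1 * g) with hH
  have hQ : BranchType k n (map (π : DualNumber K →+* K) H) := by rwa [hH, map_firstOrder]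
  have hord := hQ.order_eq hkn (by omega)
  have hm : branchMult k = 3 := by rw [branchMult, if_neg (by omega)]
  obtain ⟨ha, hb, G, β, hG, hes'⟩ := hes.exists_chart_zero hm.ge hord
  obtain ⟨s, h0, h1, h2⟩ := exists_translation_step ha hb rfl (by omega) hQ hG
    (fun hbt => exists_translation (by omega) hbt hes')
  obtain ⟨u, hu, e1⟩ := hE.one
  obtain ⟨v, hv, e2⟩ := hE.two
  rw [yCoeff_succ_X_one_mul 0] at e1
  rw [yCoeff_succ_X_one_mul 1] at e2
  have H0 : yCoeff 0 H = 0 := yCoeff_zero_X_one_mul _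
  have H1 : yCoeff 1 H =
      PowerSeries.X ^ (k + n) * PowerSeries.map (algebraMap K (DualNumber K)) u := by
    rw [hH, yCoeff_firstOrder 0, e1, yCoeff_zero_X_one_mul]; simp
  have H2 : yCoeff 2 H =
      PowerSeries.X ^ k * PowerSeries.map (algebraMap K (DualNumber K)) v +
        PowerSeries.C DualNumber.eps *
          PowerSeries.map (algebraMap K (DualNumber K)) (yCoeff 0 g) := by
    rw [hH, yCoeff_firstOrder 1, e2, yCoeff_succ_X_one_mul 0]; simp
  have hee : PowerSeries.C (DualNumber.eps : DualNumber K) * PowerSeries.C DualNumber.eps = 0 := by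
    rw [← map_mul, DualNumber.eps_mul_eps, map_zero]
  have hus := isUnit_map_of_constantCoeff_ne_zero (algebraMap K (DualNumber K)) hu
  have hsn : PowerSeries.X ^ n ∣ PowerSeries.C DualNumber.eps * s := by
    rw [H0, H1] at h0
    simp only [map_zero, mul_zero, zero_add] at h0
    obtain ⟨t, ht⟩ := h0
    rw [← hus.dvd_mul_right]
    refine ⟨t, PowerSeries.X_pow_mul_cancel (k := k + n) ?_⟩
    rw [show k + 2 * n = k + n + n by ring, pow_add _ (k + n)] at ht
    linear_combination ht
  have ha0 : a = 0 := by
    have hs2 : PowerSeries.X ^ (k + n) ∣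
        2 * (PowerSeries.C DualNumber.eps * s) * yCoeff 2 H := by
      obtain ⟨t, ht⟩ := hsn
      refine ⟨2 * t * PowerSeries.map (algebraMap K (DualNumber K)) v, ?_⟩
      rw [H2, pow_add]
      linear_combination 2 * PowerSeries.X ^ k *
        PowerSeries.map (algebraMap K (DualNumber K)) v * ht +
        2 * s * PowerSeries.map (algebraMap K (DualNumber K)) (yCoeff 0 g) * hee
    have h1' := (dvd_add_left hs2).mp h1
    have h1H : PowerSeries.X ^ (k + n) ∣ yCoeff 1 H := ⟨_, H1⟩
    rw [dvd_add_right h1H, PowerSeries.X_pow_dvd_iff] at h1'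
    have := h1' (k + n - 1) (by omega)
    rw [PowerSeries.coeff_C_mul, PowerSeries.coeff_derivative, Nat.sub_add_cancel (by omega), H1,
      PowerSeries.coeff_X_pow_mul', if_pos le_rfl, Nat.sub_self, PowerSeries.coeff_map,
      PowerSeries.coeff_zero_eq_constantCoeff_apply] at this
    have hfst : a.fst = 0 := ha
    have hsnd := congrArg TrivSqZeroExt.snd this
    have hcast : ((k + n - 1 : ℕ) : K) + 1 ≠ 0 := Nat.cast_add_one_ne_zero _
    ext
    · exact hfst
    · simpa [hfst, hu, hcast, fst_algebraMap] using hsnd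
  have hk3 : PowerSeries.X ^ k ∣ 3 * (PowerSeries.C DualNumber.eps * s) * yCoeff 3 H :=
    ((pow_dvd_pow _ hkn).trans hsn).mul_left _ |>.mul_right _
  rw [dvd_add_left hk3, ha0, map_zero, zero_mul, add_zero, H2,
    dvd_add_right (dvd_mul_right _ _)] at h2
  exact X_pow_dvd_of_eps_mul h2

end NecessaryTop

/-! ### Smooth points and nodes of the total transform -/

section Points

variable {K : Type*} [Field K]

local notation "π" => TrivSqZeroExt.fstHom K K K

lemma constantCoeff_map_fst (G : Ser (DualNumber K)) :
    constantCoeff (map (π : DualNumber K →+* K) G) = π (constantCoeff G) := by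
  simp

lemma isUnit_of_fst_ne_zero {a : DualNumber K} (h : π a ≠ 0) : IsUnit a :=
  TrivSqZeroExt.isUnit_iff_isUnit_fst.mpr (Ne.isUnit h)

lemma order_eq_zero_of_constantCoeff {f : Ser K} (h : constantCoeff f ≠ 0) : f.order = 0 := by
  simpa using order_ne_zero_iff_constCoeff_eq_zero.not.mpr h

lemma order_eq_one_of_coeff_single {f : Ser K} (h : constantCoeff f = 0) (s : Fin 2)
    (hs : coeff (Finsupp.single s 1) f ≠ 0) : f.order = 1 := by
  have := (order_eq_nat (f := f) (n := 1)).mpr ⟨⟨Finsupp.single s 1, hs, by simp⟩, ?_⟩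
  · simpa using this
  · intro d hd
    have : d = 0 := by rw [← Finsupp.degree_eq_zero_iff]; omega
    simpa [this] using h

/-- At a point off the strict transform only the smooth exceptional curve remains. -/
lemma EquisingularAlong.of_unit_mul {G : Ser (DualNumber K)} (s : Fin 2)
    (h : π (constantCoeff G) ≠ 0) : EquisingularAlong π (X s * G) 0 0 := by
  refine .smooth (map_zero _) (map_zero _) ?_ ?_
  · rw [map_mul, map_X, order_mul, order_X,
      order_eq_zero_of_constantCoeff (by rwa [constantCoeff_map_fst]), add_zero]
  · refine Ideal.mul_mem_right _ _ (Ideal.subset_span ?_)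
    fin_cases s <;> simp

lemma exists_eq_linear_zero {R : Type*} [CommRing R] (G : Ser R) :
    ∃ h h', G = C (constantCoeff G) + C (coeff (Finsupp.single 0 1) G) * X 0 + X 0 ^ 2 * h +
      X 1 * h' := by
  obtain ⟨c, q, hc⟩ := exists_eq_C_add_X_mul (yCoeff 0 G)
  obtain ⟨d, r, rfl⟩ := exists_eq_C_add_X_mul q
  have hG : G = C c + C d * X 0 + X 0 ^ 2 * inX r + X 1 * yShift G := by
    conv_lhs => rw [yCoeff_zero_add_yShift G, hc]
    simp only [inX, map_add, map_mul, PowerSeries.toMvPowerSeries_C,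
      PowerSeries.toMvPowerSeries_X]
    ring
  have h0 : constantCoeff G = c := by rw [hG]; simp
  have h1 : coeff (Finsupp.single 0 1) G = d := by
    rw [hG, coeff_single_eq_pderiv]; simp
  exact ⟨_, _, by rw [h0, h1]; exact hG⟩

lemma exists_eq_linear_one {R : Type*} [CommRing R] (G : Ser R) :
    ∃ h h', G = C (constantCoeff G) + C (coeff (Finsupp.single 1 1) G) * X 1 + X 1 ^ 2 * h +
      X 0 * h' := by
  obtain ⟨c, q, hc⟩ := exists_eq_C_add_X_mul (yCoeff 0 G)
  obtain ⟨d, r, hd⟩ := exists_eq_C_add_X_mul (yCoeff 1 G)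
  have hG : G = C c + C d * X 1 + X 1 ^ 2 * yShift (yShift G) +
      X 0 * (inX q + X 1 * inX r) := by
    conv_lhs => rw [yCoeff_zero_add_yShift G, hc, yCoeff_zero_add_yShift (yShift G),
      yCoeff_yShift, zero_add, hd]
    simp only [inX, map_add, map_mul, PowerSeries.toMvPowerSeries_C,
      PowerSeries.toMvPowerSeries_X]
    ring
  have h0 : constantCoeff G = c := by rw [hG]; simp
  have h1 : coeff (Finsupp.single 1 1) G = d := by
    rw [hG, coeff_single_eq_pderiv]; simp
  exact ⟨_, _, by rw [h0, h1]; exact hG⟩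

/-- A series `g₀ + g₁ z + …` with `g₀` infinitesimal and `g₁` a unit has the infinitesimal
zero `-g₀ / g₁`. -/
lemma exists_infinitesimal_root {g₀ g₁ : DualNumber K} (h0 : π g₀ = 0) (h1 : π g₁ ≠ 0) :
    ∃ β, π β = 0 ∧ ∀ z h : Ser (DualNumber K),
      z - C β ∣ C g₀ + C g₁ * z + z ^ 2 * h := by
  obtain ⟨i, hi⟩ := (isUnit_of_fst_ne_zero h1).exists_right_inv
  have hβ : π (-(g₀ * i)) = 0 := by rw [map_neg, map_mul, h0, zero_mul, neg_zero]
  refine ⟨-(g₀ * i), hβ, fun z h => ⟨C g₁ + (z + C (-(g₀ * i))) * h, ?_⟩⟩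
  have hC : (C (-(g₀ * i)) : Ser (DualNumber K)) * C (-(g₀ * i)) = 0 := by
    rw [← map_mul, mul_eq_zero_of_fst_eq_zero hβ hβ, map_zero]
  have hg : (C g₀ : Ser (DualNumber K)) = - (C g₁ * C (-(g₀ * i))) := by
    rw [← map_mul, ← map_neg]; congr 1; linear_combination (-g₀) * hi
  rw [hg]
  linear_combination h * hC

/-- The exceptional curve `x = 0` together with a deformation of a smooth curve transversal to it
is equisingular along some section of the exceptional curve. -/
lemma EquisingularAlong.exists_node_zero {G : Ser (DualNumber K)} (h0 : π (constantCoeff G) = 0)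
    (h1 : π (coeff (Finsupp.single 1 1) G) ≠ 0) :
    ∃ β, EquisingularAlong π (X 0 * G) 0 β := by
  obtain ⟨β, hβ, hdvd⟩ := exists_infinitesimal_root h0 h1
  obtain ⟨h, h', hG⟩ := exists_eq_linear_one G
  have hc : coeff (Finsupp.single 1 1) (map (π : DualNumber K →+* K) G) ≠ 0 := by
    rwa [coeff_map]
  refine ⟨β, .node (map_zero _) hβ ⟨?_, ?_⟩ ?_⟩
  · rw [map_mul, map_X, order_mul, order_X,
      order_eq_one_of_coeff_single (by rw [constantCoeff_map_fst, h0]) 1 hc]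
    norm_num
  · rw [map_mul, map_X, add_comm (Finsupp.single 0 1), coeff_add_single_X_mul,
      coeff_X_mul_of_eq_zero (Finsupp.single 1 2) _ _ (by simp), mul_zero, sub_zero]
    exact pow_ne_zero _ hc
  · have hX : (X 0 : Ser (DualNumber K)) ∈ idealSec 0 β := Ideal.subset_span (by simp)
    rw [pow_two]
    refine Ideal.mul_mem_mul hX ?_
    rw [hG]
    exact add_mem (Ideal.mem_of_dvd _ (hdvd _ _) (Ideal.subset_span (by simp)))
      (Ideal.mul_mem_right _ _ hX)

/-- The variant of `EquisingularAlong.exists_node_zero` for the exceptional curve `y = 0`. -/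
lemma EquisingularAlong.exists_node_one {G : Ser (DualNumber K)} (h0 : π (constantCoeff G) = 0)
    (h1 : π (coeff (Finsupp.single 0 1) G) ≠ 0) :
    ∃ β, EquisingularAlong π (X 1 * G) β 0 := by
  obtain ⟨β, hβ, hdvd⟩ := exists_infinitesimal_root h0 h1
  obtain ⟨h, h', hG⟩ := exists_eq_linear_zero G
  have hc : coeff (Finsupp.single 0 1) (map (π : DualNumber K →+* K) G) ≠ 0 := by
    rwa [coeff_map]
  refine ⟨β, .node hβ (map_zero _) ⟨?_, ?_⟩ ?_⟩
  · rw [map_mul, map_X, order_mul, order_X,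
      order_eq_one_of_coeff_single (by rw [constantCoeff_map_fst, h0]) 0 hc]
    norm_num
  · rw [map_mul, map_X, coeff_add_single_X_mul,
      coeff_X_mul_of_eq_zero (Finsupp.single 0 2) _ _ (by simp), mul_zero, zero_mul, sub_zero]
    exact pow_ne_zero _ hc
  · have hX : (X 1 : Ser (DualNumber K)) ∈ idealSec β 0 := Ideal.subset_span (by simp)
    rw [pow_two]
    refine Ideal.mul_mem_mul hX ?_
    rw [hG]
    exact add_mem (Ideal.mem_of_dvd _ (hdvd _ _) (Ideal.subset_span (by simp)))
      (Ideal.mul_mem_right _ _ hX)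

lemma EquisingularAlong.exists_of_simple {G : Ser (DualNumber K)}
    (h : π (constantCoeff G) = 0 → π (coeff (Finsupp.single 1 1) G) ≠ 0) :
    ∃ β, EquisingularAlong π (X 0 * G) 0 β := by
  by_cases h0 : π (constantCoeff G) = 0
  · exact exists_node_zero h0 (h h0)
  · exact ⟨0, of_unit_mul 0 h0⟩

end Points

/-! ### Strict transforms along the trivial section -/

section StrictTransform

variable {A : Type*} [CommRing A]

lemma subst_X_zero_eq_inX (p : PowerSeries A) : p.subst (X 0 : Ser A) = inX p := by
  rw [inX, PowerSeries.toMvPowerSeries_eq_subst]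

/-- The strict transform at `[1 : c]` of a series of multiplicity `m`, written as
`∑ x ^ (m - j) q_j y ^ j` up to higher order. -/
lemma exists_strictTransform_chart {K : Type*} [Field K] [Algebra K A] {m : ℕ} {H : Ser A}
    {q : ℕ → PowerSeries A} (hq : ∀ j ≤ m, yCoeff j H = PowerSeries.X ^ (m - j) * q j) (c : K) :
    ∃ T G, G = ∑ j ∈ Finset.range (m + 1), inX (q j) * (C (algebraMap K A c) + X 1) ^ j +
        X 0 * ((C (algebraMap K A c) + X 1) ^ (m + 1) * T) ∧
      X 0 ^ m * G = pullChart 0 0 c H := by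
  have hs : HasSubst ![(X 0 : Ser A), X 0 * (C (algebraMap K A c) + X 1)] :=
    hasSubst_pair (by simp) (by simp)
  refine ⟨subst ![(X 0 : Ser A), X 0 * (C (algebraMap K A c) + X 1)] (yShift^[m + 1] H), _, rfl, ?_⟩
  rw [pullChart]
  simp only [map_zero, zero_add]
  rw [subst_eq_sum_add hs (m + 1) H, mul_add (X 0 ^ m), Finset.mul_sum]
  refine congrArg₂ (fun a b : Ser A => a + b) (Finset.sum_congr rfl fun j hj => ?_) ?_
  · rw [hq j (by simpa [Nat.lt_succ_iff] using hj), subst_X_zero_eq_inX, inX, inX, map_mul, map_pow,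
      PowerSeries.toMvPowerSeries_X, mul_pow]
    have : (X 0 : Ser A) ^ m = X 0 ^ (m - j) * X 0 ^ j := by
      rw [← pow_add, Nat.sub_add_cancel (by simpa [Nat.lt_succ_iff] using hj)]
    rw [this]; ring
  · rw [mul_pow]; ring

lemma exists_subst_X_zero_mul_X_one (p : PowerSeries A) :
    ∃ r, p.subst (X 0 * X 1 : Ser A) = C (PowerSeries.constantCoeff p) + X 0 * X 1 * r := by
  have hs : PowerSeries.HasSubst (X 0 * X 1 : Ser A) := by
    change IsNilpotent (constantCoeff (X 0 * X 1 : Ser A)); simp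
  obtain ⟨c, q, rfl⟩ := exists_eq_C_add_X_mul p
  refine ⟨q.subst (X 0 * X 1 : Ser A), ?_⟩
  rw [← PowerSeries.coe_substAlgHom hs, map_add, map_mul]
  simp [PowerSeries.coe_substAlgHom hs, PowerSeries.subst_C, PowerSeries.subst_X hs]

/-- The strict transform at `[0 : 1]` of a series of multiplicity `m`, with its linear terms. -/
lemma exists_strictTransform_infty {m : ℕ} (hm : 2 ≤ m) {H : Ser A} {q : ℕ → PowerSeries A}
    (hq : ∀ j ≤ m, yCoeff j H = PowerSeries.X ^ (m - j) * q j) :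
    ∃ G, X 1 ^ m * G = pullInfty 0 0 H ∧
      constantCoeff G = PowerSeries.constantCoeff (q m) ∧
      coeff (Finsupp.single 0 1) G = PowerSeries.constantCoeff (q (m - 1)) := by
  have hs : HasSubst ![(X 0 * X 1 : Ser A), X 1] := hasSubst_pair (by simp) (by simp)
  have hp : PowerSeries.HasSubst (X 0 * X 1 : Ser A) := by
    change IsNilpotent (constantCoeff (X 0 * X 1 : Ser A)); simp
  choose r hr using fun j => exists_subst_X_zero_mul_X_one (q j)
  refine ⟨∑ j ∈ Finset.range (m + 1), X 0 ^ (m - j) *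
      (C (PowerSeries.constantCoeff (q j)) + X 0 * X 1 * r j) +
      X 1 * subst ![(X 0 * X 1 : Ser A), X 1] (yShift^[m + 1] H), ?_, ?_, ?_⟩
  · rw [pullInfty]
    simp only [map_zero, zero_add]
    rw [subst_eq_sum_add hs (m + 1) H, mul_add (X 1 ^ m), Finset.mul_sum]
    refine congrArg₂ (fun a b : Ser A => a + b) (Finset.sum_congr rfl fun j hj => ?_) ?_
    · have hj : j ≤ m := by simpa [Nat.lt_succ_iff] using hj
      have hX : (X 1 : Ser A) ^ m = X 1 ^ (m - j) * X 1 ^ j := by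
        rw [← pow_add, Nat.sub_add_cancel hj]
      rw [hq j hj, ← PowerSeries.coe_substAlgHom hp, map_mul, map_pow,
        PowerSeries.coe_substAlgHom hp, PowerSeries.subst_X hp, hr, hX, mul_pow]
      ring
    · rw [pow_succ]; ring
  · obtain ⟨m, rfl⟩ : ∃ l, m = l + 1 := ⟨m - 1, by omega⟩
    rw [Finset.sum_range_succ]
    have : ∀ j ∈ Finset.range (m + 1), constantCoeff (X 0 ^ (m + 1 - j) *
        (C (PowerSeries.constantCoeff (q j)) + X 0 * X 1 * r j)) = 0 := by
      intro j hj
      rw [Finset.mem_range] at hj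
      simp [zero_pow (show m + 1 - j ≠ 0 by omega)]
    rw [map_add, map_add, map_sum, Finset.sum_eq_zero this]
    simp
  · obtain ⟨m, rfl⟩ : ∃ l, m = l + 2 := ⟨m - 2, by omega⟩
    rw [Finset.sum_range_succ, Finset.sum_range_succ, coeff_single_eq_pderiv]
    have : ∀ j ∈ Finset.range (m + 1), constantCoeff (pderiv A 0 (X 0 ^ (m + 2 - j) *
        (C (PowerSeries.constantCoeff (q j)) + X 0 * X 1 * r j))) = 0 := by
      intro j hj
      rw [Finset.mem_range] at hj
      obtain ⟨l, hl⟩ : ∃ l, m + 2 - j = l + 2 := ⟨m - j, by omega⟩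
      rw [hl]
      simp [Derivation.leibniz, pow_succ]
    simp only [map_add, map_sum]
    rw [Finset.sum_eq_zero this]
    simp [show m + 2 - (m + 1) = 1 by omega]

end StrictTransform

/-! ### Equisingular first order deformations: sufficient conditions -/

section Sufficient

variable {K : Type*} [Field K]

local notation "π" => TrivSqZeroExt.fstHom K K K

/-- Membership of a deformation in the monomial ideal `⟨y, x ^ n⟩ ^ 2 * ⟨y, x ^ k⟩`. -/
structure NewtonDvd (k n : ℕ) (H : Ser (DualNumber K)) : Prop where
  zero : PowerSeries.X ^ (k + 2 * n) ∣ yCoeff 0 H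
  one : PowerSeries.X ^ (k + n) ∣ yCoeff 1 H
  two : PowerSeries.X ^ k ∣ yCoeff 2 H

lemma NewtonDvd.exists_quotients {k n : ℕ} {H : Ser (DualNumber K)} (h : NewtonDvd k n H)
    (hkn : k < n) : ∃ q : ℕ → PowerSeries (DualNumber K), ∀ j ≤ branchMult k,
      yCoeff j H = PowerSeries.X ^ (branchMult k - j) * q j := by
  have : ∀ j, ∃ t, j ≤ branchMult k → yCoeff j H = PowerSeries.X ^ (branchMult k - j) * t := by
    intro j
    by_cases hj : j ≤ branchMult k
    · suffices h : PowerSeries.X ^ (branchMult k - j) ∣ yCoeff j H from h.imp fun t ht _ => ht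
      unfold branchMult at hj ⊢
      rcases j with _ | _ | _ | _ | j
      · exact (pow_dvd_pow _ (by split_ifs <;> omega)).trans h.zero
      · exact (pow_dvd_pow _ (by split_ifs <;> omega)).trans h.one
      · exact (pow_dvd_pow _ (by split_ifs <;> omega)).trans h.two
      · split_ifs at hj ⊢
        · omega
        · simp
      · split_ifs at hj <;> omega
    · exact ⟨0, fun h => absurd h hj⟩
  choose q hq using this
  exact ⟨q, hq⟩

/-- The coefficients of the tangent cone: the constant terms of the quotients `q j`, reduced
modulo `ε`. -/
lemma BranchType.tangentCone {k n : ℕ} {H : Ser (DualNumber K)}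
    (hQ : BranchType k n (map (π : DualNumber K →+* K) H)) (hkn : k < n)
    {q : ℕ → PowerSeries (DualNumber K)} (hq : ∀ j ≤ branchMult k,
      yCoeff j H = PowerSeries.X ^ (branchMult k - j) * q j) :
    let r := fun j => π (PowerSeries.constantCoeff (q j))
    r 0 = 0 ∧ (r 1 = 0 ↔ 2 ≤ k + n) ∧ (r 2 = 0 ↔ 2 ≤ k) ∧
      (2 ≤ k → r 3 ≠ 0) := by
  intro r
  have hred : ∀ j ≤ branchMult k, yCoeff j (map (π : DualNumber K →+* K) H) =
      PowerSeries.X ^ (branchMult k - j) * PowerSeries.map (π : DualNumber K →+* K) (q j) := by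
    intro j hj
    rw [yCoeff_map, hq j hj, map_mul, map_pow, PowerSeries.map_X]
  have hr : ∀ j, r j = PowerSeries.constantCoeff
      (PowerSeries.map (π : DualNumber K →+* K) (q j)) := fun j => by
    rw [← PowerSeries.coeff_zero_eq_constantCoeff_apply, PowerSeries.coeff_map,
      PowerSeries.coeff_zero_eq_constantCoeff_apply]
    rfl
  have key : ∀ j ≤ branchMult k, ∀ (l : ℕ) (u : PowerSeries K),
      PowerSeries.constantCoeff u ≠ 0 →
      yCoeff j (map (π : DualNumber K →+* K) H) = PowerSeries.X ^ (branchMult k - j + l) * u →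
      (r j = 0 ↔ 1 ≤ l) := by
    intro j hj l u hu h
    rw [hred j hj, pow_add, mul_assoc] at h
    rw [hr, PowerSeries.X_pow_mul_cancel h, map_mul, map_pow, PowerSeries.constantCoeff_X]
    rcases l with _ | l
    · simpa using hu
    · simp
  obtain ⟨u, hu, h1⟩ := hQ.one
  obtain ⟨v, hv, h2⟩ := hQ.two
  refine ⟨?_, ?_, ?_, ?_⟩
  · have := hred 0 (Nat.zero_le _)
    rw [hQ.zero] at this
    have h0 := PowerSeries.X_pow_mul_cancel (this.symm.trans (mul_zero _).symm)
    rw [hr, h0, map_zero]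
  · rcases Nat.eq_zero_or_pos k with rfl | hk
    · rw [key 1 (by simp [branchMult]) (n - 1) u hu (by
        rw [h1]; congr 2; simp [branchMult]; omega)]
      omega
    · have hm : branchMult k = 3 := by rw [branchMult, if_neg (by omega)]
      rw [key 1 (by omega) (k + n - 2) u hu (by rw [h1]; congr 2; omega)]
      omega
  · rcases Nat.eq_zero_or_pos k with rfl | hk
    · rw [key 2 (by simp [branchMult]) 0 v hv (by rw [h2]; simp [branchMult])]
      omega
    · have hm : branchMult k = 3 := by rw [branchMult, if_neg (by omega)]
      rw [key 2 (by omega) (k - 1) v hv (by rw [h2]; congr 2; omega)]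
      omega
  · intro hk
    have hm : branchMult k = 3 := by rw [branchMult, if_neg (by omega)]
    have := hred 3 (by omega)
    rw [hm, Nat.sub_self, pow_zero, one_mul] at this
    rw [hr, ← this]
    exact hQ.three hk

/-- At a point `[1 : c]` of the exceptional curve other than an infinitely near multiple point, the
strict transform is empty, or smooth and transversal to the exceptional curve. -/
lemma BranchType.simple_of_ne {k n : ℕ} {H : Ser (DualNumber K)}
    (hQ : BranchType k n (map (π : DualNumber K →+* K) H)) (hkn : k < n)
    {q : ℕ → PowerSeries (DualNumber K)} (hq : ∀ j ≤ branchMult k,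
      yCoeff j H = PowerSeries.X ^ (branchMult k - j) * q j)
    {c : K} (hc : c ≠ 0 ∨ n = 1) {T G : Ser (DualNumber K)}
    (hG : G = ∑ j ∈ Finset.range (branchMult k + 1),
        inX (q j) * (C (algebraMap K (DualNumber K) c) + X 1) ^ j +
        X 0 * ((C (algebraMap K (DualNumber K) c) + X 1) ^ (branchMult k + 1) * T))
    (h0 : π (constantCoeff G) = 0) : π (coeff (Finsupp.single 1 1) G) ≠ 0 := by
  obtain ⟨r0, r1, r2, r3⟩ := hQ.tangentCone hkn hq
  let r := fun j => π (PowerSeries.constantCoeff (q j))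
  have hcoe : ∀ p : PowerSeries (DualNumber K), constantCoeff (pderiv (DualNumber K) 1 (inX p)) = 0 := by
    intro p
    rw [← coeff_single_eq_pderiv, coeff_inX]; simp
  have hπc : π (algebraMap K (DualNumber K) c) = c := rfl
  rw [coeff_single_eq_pderiv]
  rcases Nat.eq_zero_or_pos k with rfl | hk
  · have hm : branchMult 0 = 2 := rfl
    rw [hm] at hG
    have hr2 : π (PowerSeries.constantCoeff (q 2)) ≠ 0 := by
      intro h; have := r2.mp h; omega
    simp only [Finset.sum_range_succ, Finset.sum_range_zero] at hG
    rw [hG] at h0 ⊢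
    simp only [map_add, map_mul, map_pow, constantCoeff_inX, constantCoeff_C, constantCoeff_X,
      Derivation.leibniz, Derivation.leibniz_pow, pderiv_C, pderiv_X_self, hcoe, hπc, r0,
      smul_eq_mul, map_zero, pderiv_X_of_ne (show (0 : Fin 2) ≠ 1 by decide), nsmul_eq_mul,
      map_natCast, map_one, Nat.reduceSub, Nat.reduceAdd] at h0 ⊢
    intro h1
    change r 1 = 0 ↔ _ at r1
    change r 2 ≠ 0 at hr2
    have e0 : c * (r 1 + r 2 * c) = 0 := by linear_combination h0
    have e1 : r 1 + 2 * r 2 * c = 0 := by linear_combination h1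
    rcases hc with hc | rfl
    · have e2 : r 1 + r 2 * c = 0 := (mul_eq_zero.mp e0).resolve_left hc
      have e3 : r 2 * c = 0 := by linear_combination e1 - e2
      exact mul_ne_zero hr2 hc e3
    · have hr1 : r 1 ≠ 0 := by intro h; have := r1.mp h; omega
      refine hr1 ?_
      rcases mul_eq_zero.mp e0 with rfl | e2
      · linear_combination e1
      · linear_combination 2 * e2 - e1
  · have hm : branchMult k = 3 := by rw [branchMult, if_neg (by omega)]
    rw [hm] at hG
    simp only [Finset.sum_range_succ, Finset.sum_range_zero] at hG
    rw [hG] at h0 ⊢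
    simp only [map_add, map_mul, map_pow, constantCoeff_inX, constantCoeff_C, constantCoeff_X,
      Derivation.leibniz, Derivation.leibniz_pow, pderiv_C, pderiv_X_self, hcoe, hπc, r0,
      smul_eq_mul, map_zero, pderiv_X_of_ne (show (0 : Fin 2) ≠ 1 by decide), nsmul_eq_mul,
      map_natCast, map_one, Nat.reduceSub, Nat.reduceAdd] at h0 ⊢
    intro h1
    change r 1 = 0 ↔ _ at r1
    have hr1 : r 1 = 0 := r1.mpr (by omega)
    have hc0 : c ≠ 0 := hc.resolve_right (by omega)
    have e0 : c ^ 2 * (r 2 + r 3 * c) = 0 := by linear_combination h0 - c * hr1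
    have e1 : c * (2 * r 2 + 3 * r 3 * c) = 0 := by linear_combination h1 - hr1
    have e0' := (mul_eq_zero.mp e0).resolve_left (pow_ne_zero 2 hc0)
    have e1' := (mul_eq_zero.mp e1).resolve_left hc0
    have hr2 : r 2 = 0 := by linear_combination 3 * e0' - e1'
    have hr3 : r 3 * c = 0 := by linear_combination e0' - hr2
    exact mul_ne_zero (r3 (r2.mp hr2)) hc0 hr3

end Sufficient

section SufficientInduction

variable {K : Type*} [Field K]

local notation "π" => TrivSqZeroExt.fstHom K K K

lemma yCoeff_X_one_pow {R : Type*} [CommRing R] (i j : ℕ) :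
    yCoeff j (X 1 ^ i : Ser R) = if j = i then 1 else 0 := by
  rw [← mul_one (X 1 ^ i)]
  rcases lt_or_ge j i with h | h
  · rw [yCoeff_X_one_pow_mul_of_lt h, if_neg h.ne]
  · obtain ⟨l, rfl⟩ := Nat.exists_eq_add_of_le' h
    have h1 : (1 : Ser R) = inX 1 := by simp [inX]
    rw [yCoeff_X_one_pow_mul_add, h1]
    rcases l with _ | l
    · rw [yCoeff_zero_inX]; simp
    · rw [yCoeff_inX_succ, if_neg (by omega)]

lemma yCoeff_strictTransform {R : Type*} [CommRing R] {m : ℕ} {q : ℕ → PowerSeries R}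
    {T : Ser R} {j : ℕ} (hj : j ≤ m) :
    yCoeff j (∑ i ∈ Finset.range (m + 1), inX (q i) * X 1 ^ i + X 0 * (X 1 ^ (m + 1) * T)) =
      q j := by
  rw [map_add, yCoeff_X_zero_mul, yCoeff_X_one_pow_mul_of_lt (by omega), mul_zero, add_zero,
    map_sum]
  simp only [yCoeff_inX_mul, yCoeff_X_one_pow]
  simp [Nat.lt_succ_of_le hj]

lemma X_pow_dvd_of_mul {R : Type*} [CommRing R] {l m N : ℕ} {p : PowerSeries R}
    (h : PowerSeries.X ^ N ∣ PowerSeries.X ^ m * p) (hN : m + l ≤ N) : PowerSeries.X ^ l ∣ p := by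
  obtain ⟨t, ht⟩ := (pow_dvd_pow _ hN).trans h
  exact ⟨t, PowerSeries.X_pow_mul_cancel (k := m) (by rw [ht, pow_add, mul_assoc])⟩

lemma two_le_branchMult (k : ℕ) : 2 ≤ branchMult k := by
  unfold branchMult; split_ifs <;> omega

/-- The charts `[1 : c]` of the blow-up along the trivial section: at `[1 : 0]` the strict transform is
again inside its Newton ideal and `ih` applies, unless `n = 1`; at all other points it is simple. -/
lemma exists_charts {k n : ℕ} {H : Ser (DualNumber K)}
    (hQ : BranchType k n (map (π : DualNumber K →+* K) H)) (hN : NewtonDvd k n H) (hkn : k < n)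
    {q : ℕ → PowerSeries (DualNumber K)}
    (hq : ∀ j ≤ branchMult k, yCoeff j H = PowerSeries.X ^ (branchMult k - j) * q j)
    (ih : ∀ G, 2 ≤ n → BranchType (k - 1) (n - 1) (map (π : DualNumber K →+* K) G) →
      NewtonDvd (k - 1) (n - 1) G →
      (2 ≤ k → PowerSeries.constantCoeff (yCoeff 3 (map (π : DualNumber K →+* K) G)) ≠ 0) →
      EquisingularAlong π (X 0 * G) 0 0) (c : K) :
    ∃ G β, X 0 ^ branchMult k * G = pullChart 0 0 c H ∧ EquisingularAlong π (X 0 * G) 0 β := by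
  obtain ⟨T, G, hG, hpull⟩ := exists_strictTransform_chart hq c
  by_cases hc : c ≠ 0 ∨ n = 1
  · obtain ⟨β, hβ⟩ := EquisingularAlong.exists_of_simple (hQ.simple_of_ne hkn hq hc hG)
    exact ⟨G, β, hpull, hβ⟩
  · obtain ⟨rfl, hn⟩ : c = 0 ∧ n ≠ 1 := by simpa using hc
    have hm2 := two_le_branchMult k
    have hyG : ∀ j ≤ branchMult k, yCoeff j G = q j := by
      intro j hj
      rw [hG]
      simp only [map_zero, zero_add]
      exact yCoeff_strictTransform hj
    have hbt : BranchType (k - 1) (n - 1) (map (π : DualNumber K →+* K) G) := by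
      refine hQ.of_blowup rfl (by omega) fun j hj => ?_
      rw [yCoeff_map, yCoeff_map, hq j hj, hyG j hj, map_mul, map_pow, PowerSeries.map_X,
        ← mul_assoc, ← pow_add, Nat.add_sub_cancel' hj]
    refine ⟨G, 0, hpull, ih G (by omega) hbt ⟨?_, ?_, ?_⟩ fun hk => ?_⟩
    · have := hN.zero
      rw [hq 0 (by omega)] at this
      rw [hyG 0 (by omega)]
      refine X_pow_dvd_of_mul this ?_
      unfold branchMult; split_ifs <;> omega
    · have := hN.one
      rw [hq 1 (by omega)] at this
      rw [hyG 1 (by omega)]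
      refine X_pow_dvd_of_mul this ?_
      unfold branchMult; split_ifs <;> omega
    · rcases Nat.eq_zero_or_pos k with rfl | hk
      · simp
      have := hN.two
      rw [hq 2 (by omega)] at this
      rw [hyG 2 (by omega)]
      refine X_pow_dvd_of_mul this ?_
      unfold branchMult; split_ifs <;> omega
    · have hm : branchMult k = 3 := by rw [branchMult, if_neg (by omega)]
      have h3 := hQ.three hk
      rw [yCoeff_map, hq 3 (by omega), hm, Nat.sub_self, pow_zero, one_mul] at h3
      rwa [yCoeff_map, hyG 3 (by omega)]

lemma X_mem_idealSec_zero {A : Type*} [CommRing A] (s : Fin 2) :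
    (X s : Ser A) ∈ idealSec (0 : A) 0 :=
  Ideal.subset_span (by fin_cases s <;> simp)

/-- Equimultiplicity along the trivial section. -/
lemma mem_idealSec_pow {A : Type*} [CommRing A] {m : ℕ} {H : Ser A} {q : ℕ → PowerSeries A}
    (hq : ∀ j ≤ m, yCoeff j H = PowerSeries.X ^ (m - j) * q j) :
    H ∈ idealSec (0 : A) 0 ^ m := by
  rw [eq_sum_add_iterate_yShift m H]
  refine add_mem (sum_mem fun j hj => ?_)
    (Ideal.mul_mem_right _ _ (Ideal.pow_mem_pow (X_mem_idealSec_zero 1) m))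
  have hj : j ≤ m := (Finset.mem_range.mp hj).le
  have hX : inX (yCoeff j H) * X 1 ^ j = X 0 ^ (m - j) * X 1 ^ j * inX (q j) := by
    rw [hq j hj, inX, map_mul, map_pow, PowerSeries.toMvPowerSeries_X]; ring
  rw [hX, ← Nat.sub_add_cancel hj, pow_add _ (m - j) j, Nat.sub_add_cancel hj]
  exact Ideal.mul_mem_right _ _ (Ideal.mul_mem_mul
    (Ideal.pow_mem_pow (X_mem_idealSec_zero 0) _) (Ideal.pow_mem_pow (X_mem_idealSec_zero 1) _))

lemma X_zero_mul_mem_idealSec_pow {A : Type*} [CommRing A] {m : ℕ} {H : Ser A}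
    (h : H ∈ idealSec (0 : A) 0 ^ m) : X 0 * H ∈ idealSec (0 : A) 0 ^ (m + 1) := by
  rw [pow_succ']
  exact Ideal.mul_mem_mul (X_mem_idealSec_zero 0) h

lemma not_isNode_of_order {F : Ser K} {m : ℕ} (hm : 3 ≤ m) (hF : F.order = m) : ¬ IsNode F := by
  intro h
  have : (2 : ℕ) = m := by exact_mod_cast h.1.symm.trans hF
  omega

/-- A deformation inside the Newton ideal, together with the exceptional curve `x = 0`, is
equisingular along the trivial section. The condition on the coefficient of `y ^ 3` says that the
third branch is transversal to the exceptional curve; for `k = 1` it could be tangent to it. -/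
lemma EquisingularAlong.of_newtonDvd {n : ℕ} : ∀ {k : ℕ} {H : Ser (DualNumber K)}, k < n →
    BranchType k n (map (π : DualNumber K →+* K) H) → NewtonDvd k n H →
    (1 ≤ k → PowerSeries.constantCoeff (yCoeff 3 (map (π : DualNumber K →+* K) H)) ≠ 0) →
    EquisingularAlong π (X 0 * H) 0 0 := by
  induction n with
  | zero => intro k H h; omega
  | succ n ih =>
    intro k H hkn hQ hN hA
    have hm2 := two_le_branchMult k
    obtain ⟨q, hq⟩ := hN.exists_quotients hkn
    have hord : (map (π : DualNumber K →+* K) (X 0 * H)).order = (branchMult k + 1 : ℕ) := by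
      rw [map_mul, map_X, order_mul, order_X, hQ.order_eq hkn.le (by omega)]
      push_cast; ring
    have hcharts := exists_charts hQ hN hkn hq (fun G hn hbt hNG h3 => by
      rcases Nat.eq_zero_or_pos k with rfl | hk
      · exact ih (by omega) hbt hNG (fun h => by omega)
      · exact ih (by omega) hbt hNG (fun h => h3 (by omega)))
    choose G β hG hes using hcharts
    obtain ⟨G', hG', hG0, -⟩ := exists_strictTransform_infty hm2 hq
    have hlead : π (PowerSeries.constantCoeff (q (branchMult k))) ≠ 0 := by
      obtain ⟨-, -, r2, -⟩ := hQ.tangentCone hkn hq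
      rcases Nat.eq_zero_or_pos k with rfl | hk
      · intro h; have := r2.mp h; omega
      · have hm : branchMult k = 3 := by rw [branchMult, if_neg (by omega)]
        have h3 := hA hk
        rw [yCoeff_map, hq 3 (by omega), hm, Nat.sub_self, pow_zero, one_mul,
          ← PowerSeries.coeff_zero_eq_constantCoeff_apply, PowerSeries.coeff_map,
          PowerSeries.coeff_zero_eq_constantCoeff_apply] at h3
        rwa [hm]
    obtain ⟨β', hβ'⟩ := EquisingularAlong.exists_node_one (G := X 0 * G') (by simp) (by
      rw [coeff_single_mul]
      simp only [constantCoeff_X, zero_mul, zero_add, coeff_index_single_self_X, mul_one, hG0]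
      exact hlead)
    refine .blowup (map_zero _) (map_zero _) (branchMult k + 1) (by omega) hord
      (not_isNode_of_order (by omega) hord) ?_ G β (fun c => ?_) hes (X 0 * G') β' ?_ hβ'
    · exact X_zero_mul_mem_idealSec_pow (mem_idealSec_pow hq)
    · have hs : HasSubst ![(C 0 + X 0 : Ser (DualNumber K)),
          C 0 + X 0 * (C (algebraMap K (DualNumber K) c) + X 1)] :=
        hasSubst_pair (by simp) (by simp)
      rw [pow_succ', mul_assoc, hG, pullChart, pullChart, subst_mul hs, subst_X_zero hs, map_zero,
        zero_add]
    · have hs : HasSubst ![(C 0 + X 0 * X 1 : Ser (DualNumber K)), C 0 + X 1] :=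
        hasSubst_pair (by simp) (by simp)
      have : (X 1 : Ser (DualNumber K)) ^ (branchMult k + 1) * (X 0 * G') =
          X 0 * X 1 * (X 1 ^ branchMult k * G') := by ring
      rw [this, hG', pullInfty, pullInfty, subst_mul hs, subst_X_zero hs, map_zero, zero_add]

/-- A deformation inside the Newton ideal of three branches is equisingular. -/
lemma EquisingularAlong.of_newtonDvd_of_pos {k n : ℕ} {H : Ser (DualNumber K)} (hk : 1 ≤ k)
    (hkn : k < n) (hQ : BranchType k n (map (π : DualNumber K →+* K) H)) (hN : NewtonDvd k n H) :
    EquisingularAlong π H 0 0 := by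
  have hm : branchMult k = 3 := by rw [branchMult, if_neg (by omega)]
  obtain ⟨q, hq⟩ := hN.exists_quotients hkn
  have hord := hQ.order_eq hkn.le (by omega)
  have hcharts := exists_charts hQ hN hkn hq (fun G hn hbt hNG h3 =>
    of_newtonDvd (by omega) hbt hNG (fun h => h3 (by omega)))
  choose G β hG hes using hcharts
  obtain ⟨G', hG', hG0, hG1⟩ := exists_strictTransform_infty (two_le_branchMult k) hq
  have hinfty : ∃ β', EquisingularAlong π (X 1 * G') β' 0 := by
    by_cases h0 : π (constantCoeff G') = 0
    · obtain ⟨-, -, r2, r3⟩ := hQ.tangentCone hkn hq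
      refine exists_node_one h0 ?_
      rw [hG0, hm] at h0
      rw [hG1, hm]
      intro h2
      exact r3 (r2.mp h2) h0
    · exact ⟨0, of_unit_mul 1 h0⟩
  obtain ⟨β', hβ'⟩ := hinfty
  exact .blowup (map_zero _) (map_zero _) (branchMult k) (two_le_branchMult k) hord
    (not_isNode_of_order hm.ge hord) (mem_idealSec_pow hq) G β hG hes G' β' hG' hβ'

end SufficientInduction

/-! ### The ideal `⟨y, x ^ k⟩` -/

section MonomialIdeal

variable {K : Type*} [Field K]

lemma mem_span_X_one_X_zero_pow {R : Type*} [CommRing R] {k : ℕ} {g : Ser R} :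
    g ∈ (Ideal.span {X 1, X 0 ^ k} : Ideal (Ser R)) ↔ PowerSeries.X ^ k ∣ yCoeff 0 g := by
  rw [Ideal.mem_span_pair]
  constructor
  · rintro ⟨a, b, rfl⟩
    rw [mul_comm a, mul_comm b, map_add, yCoeff_zero_X_one_mul, zero_add, yCoeff_X_zero_pow_mul]
    exact dvd_mul_right _ _
  · rintro ⟨t, ht⟩
    refine ⟨yShift g, inX t, ?_⟩
    conv_rhs => rw [yCoeff_zero_add_yShift g, ht]
    rw [inX, inX, map_mul, map_pow, PowerSeries.toMvPowerSeries_X]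
    ring

/-- The logarithmic equisingular ideal of a curve of the given branch type. -/
theorem iesLog_eq [CharZero K] {k n : ℕ} (hk : 1 ≤ k) (hkn : k < n) {E : Ser K}
    (hE : BranchType k n (X 1 * E)) :
    iesLog E = ((Ideal.span {X 1, X 0 ^ k} : Ideal (Ser K)) : Set (Ser K)) := by
  ext g
  rw [SetLike.mem_coe, mem_span_X_one_X_zero_pow]
  constructor
  · intro h
    have := h (X 1) (Ideal.subset_span rfl)
    rw [mul_comm] at this
    exact X_pow_dvd_of_equisingular hk hkn.le hE this
  · intro hg h hh
    obtain ⟨t, rfl⟩ := Ideal.mem_span_singleton'.mp hh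
    rw [← mul_assoc]
    have hgt : PowerSeries.X ^ k ∣ yCoeff 0 (g * t) := by
      rw [← mem_span_X_one_X_zero_pow] at hg ⊢
      exact Ideal.mul_mem_right _ _ hg
    generalize g * t = g' at hgt
    obtain ⟨u, hu, e1⟩ := hE.one
    obtain ⟨v, hv, e2⟩ := hE.two
    rw [yCoeff_succ_X_one_mul 0] at e1
    rw [yCoeff_succ_X_one_mul 1] at e2
    refine ⟨0, 0, .of_newtonDvd_of_pos hk hkn (by rwa [map_firstOrder]) ⟨?_, ?_, ?_⟩⟩
    · rw [yCoeff_zero_X_one_mul]; exact dvd_zero _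
    · rw [yCoeff_firstOrder 0, e1, mul_comm g', yCoeff_zero_X_one_mul, map_zero, mul_zero, add_zero]
      exact X_pow_dvd_map _ (dvd_mul_right _ _)
    · rw [yCoeff_firstOrder 1, e2, mul_comm g', yCoeff_succ_X_one_mul 0]
      exact dvd_add (X_pow_dvd_map _ (dvd_mul_right _ _)) ((X_pow_dvd_map _ hgt).mul_left _)

/-- The quotient by `⟨y, x ^ k⟩` has the basis `1, x, …, x ^ (k - 1)`. -/
lemma finrank_quotient_span_X_one_X_zero_pow (k : ℕ) :
    Module.finrank K (Ser K ⧸ (Ideal.span {X 1, X 0 ^ k} : Ideal (Ser K))) = k := by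
  let f : Ser K →ₗ[K] (Fin k → K) :=
    LinearMap.pi fun i => (PowerSeries.coeff (i : ℕ)).comp (yCoeff 0)
  have hker : LinearMap.ker f =
      (Ideal.span {X 1, X 0 ^ k} : Ideal (Ser K)).restrictScalars K := by
    ext g
    rw [LinearMap.mem_ker, Submodule.restrictScalars_mem, mem_span_X_one_X_zero_pow,
      PowerSeries.X_pow_dvd_iff, funext_iff]
    exact ⟨fun h m hm => h ⟨m, hm⟩, fun h i => h i i.2⟩
  have hsurj : Function.Surjective f := by
    intro v
    refine ⟨inX (PowerSeries.mk fun i => if h : i < k then v ⟨i, h⟩ else 0), ?_⟩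
    ext i
    simp [f, yCoeff_zero_inX]
  rw [← (Submodule.Quotient.restrictScalarsEquiv K _).finrank_eq,
    ← (Submodule.quotEquivOfEq _ _ hker).finrank_eq,
    (f.quotKerEquivOfSurjective hsurj).finrank_eq, Module.finrank_fin_fun]

lemma tauEsLog_eq [CharZero K] {k n : ℕ} (hk : 1 ≤ k) (hkn : k < n) {E : Ser K}
    (hE : BranchType k n (X 1 * E)) : tauEsLog E = k := by
  rw [tauEsLog, iesLog_eq hk hkn hE]
  have : Submodule.span K ((Ideal.span {X 1, X 0 ^ k} : Ideal (Ser K)) : Set (Ser K)) =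
      (Ideal.span {X 1, X 0 ^ k} : Ideal (Ser K)).restrictScalars K :=
    Submodule.span_eq ((Ideal.span {X 1, X 0 ^ k} : Ideal (Ser K)).restrictScalars K)
  rw [this, (Submodule.Quotient.restrictScalarsEquiv K _).finrank_eq]
  exact finrank_quotient_span_X_one_X_zero_pow k

end MonomialIdeal

/-! ### The equianalytic ideal -/

section Equianalytic

variable {K : Type*} [Field K]

lemma mem_idealD {h : Ser K} : h ∈ idealD K ↔ X 1 ∣ h := Ideal.mem_span_singleton

lemma mem_idealP {h : Ser K} : h ∈ idealP K ↔ constantCoeff h = 0 := by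
  have := mem_span_X_one_X_zero_pow (k := 1) (g := h)
  rw [idealP, Set.pair_comm, constantCoeff_eq_yCoeff, ← PowerSeries.X_dvd_iff]
  rwa [pow_one, pow_one] at this

lemma mem_ieaLog {F g : Ser K} : g ∈ ieaLog F ↔ g * X 1 ∈ ieaRel F := by
  rw [ieaLog, Submodule.mem_colon]
  constructor
  · intro h; exact h _ (Ideal.subset_span rfl)
  · intro h s hs
    obtain ⟨t, rfl⟩ := mem_idealD.mp hs
    rw [smul_eq_mul, ← mul_assoc]
    exact Ideal.mul_mem_right _ _ h

lemma derivation_mem_ieaRel {F : Ser K} {δ : Derivation K (Ser K) (Ser K)} (hδ : δ ∈ derDP K) :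
    δ F ∈ ieaRel F :=
  Ideal.mem_sup_left (Ideal.subset_span ⟨δ, hδ, rfl⟩)

lemma self_mem_ieaRel (F : Ser K) : F ∈ ieaRel F :=
  Ideal.mem_sup_right (Ideal.subset_span rfl)

/-- The Euler fields `x ∂/∂x` and `y ∂/∂y` preserve `D` and `P`. -/
lemma X_smul_pderiv_mem_derDP (s : Fin 2) : (X s : Ser K) • pderiv K s ∈ derDP K := by
  constructor
  · intro h hh
    obtain ⟨t, rfl⟩ := mem_idealD.mp hh
    rw [mem_idealD]
    fin_cases s
    · simp only [Fin.zero_eta, Derivation.smul_apply, Derivation.leibniz, smul_eq_mul,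
        pderiv_X_of_ne (show (1 : Fin 2) ≠ 0 by decide)]
      exact ⟨X 0 * pderiv K 0 t, by ring⟩
    · simp only [Fin.mk_one, Derivation.smul_apply, smul_eq_mul]
      exact dvd_mul_right _ _
  · intro h _
    rw [mem_idealP]
    simp [Derivation.smul_apply]

/-- The equianalytic ideal of a curve with two branches `y + x ^ k` and `y + x ^ n`, `n > k`. The
Euler fields and `F` itself give `y²` and `y x ^ k`, because the determinant of their coefficients
with respect to `y²`, `y x ^ k` and `x ^ (k + n)` is `n - k` up to a unit. -/
theorem ieaLog_eq [CharZero K] {k n : ℕ} (hk : 1 ≤ k) (hkn : k < n) :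
    ieaLog ((X 1 + X 0 ^ k) * (X 1 + X 0 ^ n) : Ser K) = Ideal.span {X 1, X 0 ^ k} := by
  obtain ⟨d, rfl⟩ : ∃ d, n = k + d := ⟨n - k, by omega⟩
  have hd : d ≠ 0 := by omega
  set F : Ser K := (X 1 + X 0 ^ k) * (X 1 + X 0 ^ (k + d)) with hF
  apply le_antisymm
  · intro g hg
    rw [mem_ieaLog] at hg
    rw [mem_span_X_one_X_zero_pow]
    have hle : ieaRel F ≤ Ideal.span {X 1 ^ 2, X 0 ^ k} := by
      refine sup_le (Ideal.span_le.mpr ?_) (Ideal.span_le.mpr ?_)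
      · rintro _ ⟨δ, hδ, rfl⟩
        obtain ⟨b, hb⟩ := mem_idealD.mp (hδ.1 (X 1) (Ideal.subset_span rfl))
        have hx := hδ.2 (X 0) (Ideal.subset_span (by simp))
        rw [idealP, Ideal.mem_span_pair] at hx
        obtain ⟨p, q, hx⟩ := hx
        rw [SetLike.mem_coe, Ideal.mem_span_pair]
        obtain ⟨l, rfl⟩ : ∃ l, k = l + 1 := ⟨k - 1, by omega⟩
        refine ⟨q * (((l : Ser K) + 1) * X 0 ^ l + ((l : Ser K) + 1 + (d : Ser K)) * X 0 ^ (l + d)) + 2 * b,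
          X 1 * (p * (((l : Ser K) + 1) + ((l : Ser K) + 1 + (d : Ser K)) * X 0 ^ d) + b * (1 + X 0 ^ d) +
            (2 * ((l : Ser K) + 1) + (d : Ser K)) * q * X 0 ^ (l + d)) +
            (2 * ((l : Ser K) + 1) + (d : Ser K)) * p * X 0 ^ (l + 1 + d), ?_⟩
        rw [hF, Derivation.leibniz, map_add, map_add, Derivation.leibniz_pow,
          Derivation.leibniz_pow, hb, ← hx]
        simp only [smul_eq_mul, nsmul_eq_mul, Nat.add_sub_cancel,
          show l + 1 + d - 1 = l + d by omega]
        push_cast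
        ring
      · rw [Set.singleton_subset_iff, SetLike.mem_coe, Ideal.mem_span_pair]
        exact ⟨1, X 1 * (1 + X 0 ^ d) + X 0 ^ (k + d), by rw [hF]; ring⟩
    have := hle hg
    rw [Ideal.mem_span_pair] at this
    obtain ⟨a, b, hab⟩ := this
    refine ⟨yCoeff 1 b, ?_⟩
    have h1 := congrArg (yCoeff 1) hab
    rw [mul_comm g, mul_comm a, mul_comm b, map_add, yCoeff_X_one_pow_mul_of_lt (by omega),
      yCoeff_X_zero_pow_mul, zero_add, yCoeff_succ_X_one_mul 0] at h1
    exact h1.symm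
  · have hx := derivation_mem_ieaRel (F := F) (X_smul_pderiv_mem_derDP 0)
    have hy := derivation_mem_ieaRel (F := F) (X_smul_pderiv_mem_derDP 1)
    have hself := self_mem_ieaRel F
    have ex : ((X 0 : Ser K) • pderiv K 0 : Derivation K (Ser K) (Ser K)) F =
        (X 1 : Ser K) * ((k : Ser K) * X 0 ^ k + ((k : Ser K) + (d : Ser K)) * X 0 ^ (k + d)) +
          (2 * (k : Ser K) + (d : Ser K)) * X 0 ^ (2 * k + d) := by
      obtain ⟨l, rfl⟩ : ∃ l, k = l + 1 := ⟨k - 1, by omega⟩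
      rw [hF, Derivation.smul_apply, Derivation.leibniz, map_add, map_add, Derivation.leibniz_pow,
        Derivation.leibniz_pow, pderiv_X_self, pderiv_X_of_ne (by decide)]
      simp only [smul_eq_mul, nsmul_eq_mul, Nat.add_sub_cancel,
        show l + 1 + d - 1 = l + d by omega]
      push_cast
      ring
    have ey : ((X 1 : Ser K) • pderiv K 1 : Derivation K (Ser K) (Ser K)) F =
        2 * X 1 ^ 2 + X 1 * (X 0 ^ k + X 0 ^ (k + d)) := by
      rw [hF, Derivation.smul_apply, Derivation.leibniz, map_add, map_add, Derivation.leibniz_pow,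
        Derivation.leibniz_pow, pderiv_X_self, pderiv_X_of_ne (by decide)]
      simp only [smul_eq_mul, nsmul_eq_mul]
      ring
    rw [ex] at hx
    rw [ey] at hy
    have hu : IsUnit ((d : Ser K) * (1 - X 0 ^ d)) := by
      rw [isUnit_iff_constantCoeff]
      simp [hd]
    have hyx : X 1 * X 0 ^ k ∈ ieaRel F := by
      have hmem : X 1 * X 0 ^ k * ((d : Ser K) * (1 - X 0 ^ d)) ∈ ieaRel F := by
        have : X 1 * X 0 ^ k * ((d : Ser K) * (1 - X 0 ^ d)) =
            (-2 : Ser K) * (X 1 * ((k : Ser K) * X 0 ^ k + ((k : Ser K) + (d : Ser K)) * X 0 ^ (k + d)) +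
              (2 * (k : Ser K) + (d : Ser K)) * X 0 ^ (2 * k + d)) + 2 * (2 * (k : Ser K) + (d : Ser K)) * F +
            (-(2 * (k : Ser K) + (d : Ser K))) * (2 * X 1 ^ 2 + X 1 * (X 0 ^ k + X 0 ^ (k + d))) := by
          rw [hF]; ring
        rw [this]
        exact add_mem (add_mem (Ideal.mul_mem_left _ _ hx) (Ideal.mul_mem_left _ _ hself))
          (Ideal.mul_mem_left _ _ hy)
      exact (Ideal.mul_unit_mem_iff_mem _ hu).mp hmem
    have hyy : X 1 * X 1 ∈ ieaRel F := by
      have h2 : IsUnit (2 : Ser K) := by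
        rw [isUnit_iff_constantCoeff, map_ofNat constantCoeff 2]
        exact two_ne_zero.isUnit
      refine (Ideal.unit_mul_mem_iff_mem _ h2).mp ?_
      have : (2 : Ser K) * (X 1 * X 1) = (2 * X 1 ^ 2 + X 1 * (X 0 ^ k + X 0 ^ (k + d))) -
          (1 + X 0 ^ d) * (X 1 * X 0 ^ k) := by ring
      rw [this]
      exact sub_mem hy (Ideal.mul_mem_left _ _ hyx)
    rw [Ideal.span_le]
    rintro g (rfl | rfl)
    · exact mem_ieaLog.mpr hyy
    · exact mem_ieaLog.mpr (by rwa [mul_comm])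

end Equianalytic

/-! ### Invariance of the equianalytic ideal -/

section Invariance

variable {K : Type*} [Field K]

lemma constantCoeff_algEquiv_eq_zero (φ : Ser K ≃ₐ[K] Ser K) {h : Ser K} :
    constantCoeff (φ h) = 0 ↔ constantCoeff h = 0 := by
  rw [← not_iff_not, ← ne_eq, ← ne_eq, ← isUnit_iff_ne_zero, ← isUnit_iff_ne_zero,
    ← isUnit_iff_constantCoeff, ← isUnit_iff_constantCoeff, MulEquiv.isUnit_map]

/-- The conjugate of a derivation by an automorphism. -/
noncomputable def conjDerivation (φ : Ser K ≃ₐ[K] Ser K) (δ : Derivation K (Ser K) (Ser K)) :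
    Derivation K (Ser K) (Ser K) :=
  Derivation.mk' (φ.toLinearMap ∘ₗ (δ : Ser K →ₗ[K] Ser K) ∘ₗ φ.symm.toLinearMap) fun a b => by
    simp [Derivation.leibniz]

lemma conjDerivation_apply (φ : Ser K ≃ₐ[K] Ser K) (δ : Derivation K (Ser K) (Ser K)) (a : Ser K) :
    conjDerivation φ δ a = φ (δ (φ.symm a)) := rfl

lemma map_symm_eq {φ : Ser K ≃ₐ[K] Ser K} {I J : Ideal (Ser K)} (h : I.map φ = J) :
    J.map φ.symm = I := by
  rw [← h]
  ext g
  constructor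
  · intro hg
    obtain ⟨a, ha, rfl⟩ := (Ideal.mem_map_iff_of_surjective _ φ.symm.surjective).mp hg
    obtain ⟨b, hb, rfl⟩ := (Ideal.mem_map_iff_of_surjective _ φ.surjective).mp ha
    rwa [AlgEquiv.symm_apply_apply]
  · intro hg
    have := Ideal.mem_map_of_mem φ.symm (Ideal.mem_map_of_mem φ hg)
    rwa [AlgEquiv.symm_apply_apply] at this

lemma algEquiv_mem_ieaRel {φ : Ser K ≃ₐ[K] Ser K} (hD : (idealD K).map φ = idealD K)
    {E F : Ser K} (hEF : (Ideal.span {E}).map φ = Ideal.span {F}) {g : Ser K}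
    (hg : g ∈ ieaRel E) : φ g ∈ ieaRel F := by
  have hE : φ E ∈ Ideal.span {F} := hEF ▸ Ideal.mem_map_of_mem φ (Ideal.subset_span rfl)
  suffices h : ieaRel E ≤ (ieaRel F).comap φ from h hg
  refine sup_le (Ideal.span_le.mpr ?_) (Ideal.span_le.mpr ?_)
  · rintro _ ⟨δ, hδ, rfl⟩
    have hδ' : conjDerivation φ δ ∈ derDP K := by
      constructor
      · intro h hh
        rw [conjDerivation_apply, ← hD]
        refine Ideal.mem_map_of_mem φ (hδ.1 _ ?_)
        rw [← map_symm_eq hD]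
        exact Ideal.mem_map_of_mem φ.symm hh
      · intro h hh
        rw [conjDerivation_apply, mem_idealP, constantCoeff_algEquiv_eq_zero, ← mem_idealP]
        exact hδ.2 _ (by rwa [mem_idealP, constantCoeff_algEquiv_eq_zero, ← mem_idealP])
    obtain ⟨u, hu⟩ := Ideal.mem_span_singleton'.mp hE
    change φ (δ E) ∈ ieaRel F
    have : φ (δ E) = conjDerivation φ δ (u * F) := by
      rw [hu, conjDerivation_apply, AlgEquiv.symm_apply_apply]
    rw [this, Derivation.leibniz]
    exact add_mem (Ideal.mul_mem_left _ _ (derivation_mem_ieaRel hδ'))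
      (Ideal.mul_mem_right _ _ (self_mem_ieaRel F))
  · rw [Set.singleton_subset_iff]
    exact Ideal.mem_sup_right hE

lemma algEquiv_mem_ieaLog {φ : Ser K ≃ₐ[K] Ser K} (hD : (idealD K).map φ = idealD K)
    {E F : Ser K} (hEF : (Ideal.span {E}).map φ = Ideal.span {F}) {g : Ser K}
    (hg : g ∈ ieaLog E) : φ g ∈ ieaLog F := by
  rw [mem_ieaLog] at hg ⊢
  have hX : (X 1 : Ser K) ∈ (idealD K).map φ := by
    rw [hD]; exact Ideal.subset_span rfl
  obtain ⟨a, ha, haX⟩ := (Ideal.mem_map_iff_of_surjective _ φ.surjective).mp hX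
  obtain ⟨t, rfl⟩ := mem_idealD.mp ha
  rw [← haX, ← map_mul]
  refine algEquiv_mem_ieaRel hD hEF ?_
  rw [← mul_assoc]
  exact Ideal.mul_mem_right _ _ hg

/-- Equivalent curves have the same `τ_log`. -/
lemma Equivalent.tauLog_eq {E F : Ser K} (h : Equivalent E F) : tauLog E = tauLog F := by
  obtain ⟨φ, hD, hEF⟩ := h
  have hmap : ieaLog F = (ieaLog E).map (φ : Ser K →+* Ser K) := by
    apply le_antisymm
    · intro g hg
      have := algEquiv_mem_ieaLog (map_symm_eq hD) (map_symm_eq hEF) hg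
      have := Ideal.mem_map_of_mem (φ : Ser K →+* Ser K) this
      simpa using this
    · rw [Ideal.map_le_iff_le_comap]
      intro g hg
      exact algEquiv_mem_ieaLog hD hEF hg
  exact (Ideal.quotientEquivAlg _ _ φ hmap).toLinearEquiv.finrank_eq

end Invariance

/-! ### Coordinate changes -/

section CoordinateChanges

variable {K : Type*} [Field K]

lemma subst_subst_pair {u v u' v' : Ser K} (h : HasSubst ![u, v]) (h' : HasSubst ![u', v'])
    (f : Ser K) : subst ![u', v'] (subst ![u, v] f) =
      subst ![subst ![u', v'] u, subst ![u', v'] v] f := by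
  rw [subst_comp_subst_apply h h']
  congr 1
  ext s
  fin_cases s <;> rfl

lemma subst_X_pair (f : Ser K) : subst ![(X 0 : Ser K), X 1] f = f := by
  have : ![(X 0 : Ser K), X 1] = X := by ext s; fin_cases s <;> rfl
  rw [this, subst_self]; rfl

/-- The automorphism of `K[[x, y]]` given by a substitution with a two-sided inverse. -/
noncomputable def substEquiv {u v u' v' : Ser K} (h : HasSubst ![u, v]) (h' : HasSubst ![u', v'])
    (e0 : subst ![u', v'] u = X 0) (e1 : subst ![u', v'] v = X 1)
    (e0' : subst ![u, v] u' = X 0) (e1' : subst ![u, v] v' = X 1) : Ser K ≃ₐ[K] Ser K :=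
  AlgEquiv.ofAlgHom (substAlgHom h) (substAlgHom h')
    (AlgHom.ext fun f => by
      simp only [AlgHom.comp_apply, substAlgHom_apply, AlgHom.id_apply]
      rw [subst_subst_pair h' h, e0', e1', subst_X_pair])
    (AlgHom.ext fun f => by
      simp only [AlgHom.comp_apply, substAlgHom_apply, AlgHom.id_apply]
      rw [subst_subst_pair h h', e0, e1, subst_X_pair])

lemma substEquiv_apply {u v u' v' : Ser K} (h : HasSubst ![u, v]) (h' : HasSubst ![u', v'])
    (e0 : subst ![u', v'] u = X 0) (e1 : subst ![u', v'] v = X 1)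
    (e0' : subst ![u, v] u' = X 0) (e1' : subst ![u, v] v' = X 1) (f : Ser K) :
    substEquiv h h' e0 e1 e0' e1' f = subst ![u, v] f := substAlgHom_apply h f

lemma exists_shear (c : K) : ∃ φ : Ser K ≃ₐ[K] Ser K,
    φ (X 0) = X 0 + C c * X 1 ∧ φ (X 1) = X 1 := by
  have h : HasSubst ![(X 0 + C c * X 1 : Ser K), X 1] := hasSubst_pair (by simp) (by simp)
  have h' : HasSubst ![(X 0 - C c * X 1 : Ser K), X 1] := hasSubst_pair (by simp) (by simp)
  have hC : ∀ {u v : Ser K} (h : HasSubst ![u, v]), subst ![u, v] (C c : Ser K) = C c :=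
    fun h => subst_C c
  refine ⟨substEquiv h h' ?_ (subst_X_one h') ?_ (subst_X_one h), ?_, ?_⟩
  · rw [subst_add h', subst_mul h', subst_X_zero h', subst_X_one h', hC h']; ring
  · rw [subst_sub h, subst_mul h, subst_X_zero h, subst_X_one h, hC h]; ring
  · rw [substEquiv_apply, subst_X_zero h]
  · rw [substEquiv_apply, subst_X_one h]

lemma powerSeries_hasSubst {a : PowerSeries K} (ha : PowerSeries.constantCoeff a = 0) :
    PowerSeries.HasSubst a := PowerSeries.HasSubst.of_constantCoeff_zero' ha

lemma subst_inX_eq {r : PowerSeries K} (hr : PowerSeries.constantCoeff r = 0)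
    (p : PowerSeries K) : p.subst (inX r) = inX (p.subst r) := by
  rw [inX, inX, PowerSeries.toMvPowerSeries_eq_subst, PowerSeries.toMvPowerSeries_eq_subst,
    PowerSeries.subst_comp_subst_apply (powerSeries_hasSubst hr) (PowerSeries.HasSubst.X 0)]

/-- The automorphism `x ↦ a(x)`, `y ↦ y b(x)`, with `a` of order one and `b` a unit. -/
lemma exists_rescaling {a b : PowerSeries K} (ha : PowerSeries.constantCoeff a = 0)
    (ha1 : PowerSeries.coeff 1 a ≠ 0) (hb : PowerSeries.constantCoeff b ≠ 0) :
    ∃ φ : Ser K ≃ₐ[K] Ser K, φ (X 0) = inX a ∧ φ (X 1) = X 1 * inX b := by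
  obtain ⟨a', ha', haa', ha'a⟩ : ∃ a' : PowerSeries K, PowerSeries.constantCoeff a' = 0 ∧
      a.subst a' = PowerSeries.X ∧ a'.subst a = PowerSeries.X :=
    ⟨a.substInvOfIsUnit ha1.isUnit, PowerSeries.constantCoeff_substInvOfIsUnit _ _,
      PowerSeries.subst_substInvOfIsUnit_right _ ha _,
      PowerSeries.subst_substInvOfIsUnit_left _ ha _⟩
  obtain ⟨b', hb'⟩ := (PowerSeries.isUnit_iff_constantCoeff.mpr hb.isUnit).exists_right_inv
  have h : HasSubst ![inX a, X 1 * inX b] :=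
    hasSubst_pair (by rw [constantCoeff_inX, ha]; exact IsNilpotent.zero) (by simp)
  have h' : HasSubst ![inX a', X 1 * inX (b'.subst a')] :=
    hasSubst_pair (by rw [constantCoeff_inX, ha']; exact IsNilpotent.zero) (by simp)
  have hs := powerSeries_hasSubst ha
  have hs' := powerSeries_hasSubst ha'
  have hbb : b.subst a' * b'.subst a' = 1 := by
    rw [← PowerSeries.subst_mul hs', hb', ← PowerSeries.coe_substAlgHom hs', map_one]
  have hinX : inX (PowerSeries.X : PowerSeries K) = X 0 := PowerSeries.toMvPowerSeries_X 0
  refine ⟨substEquiv h h' ?_ ?_ ?_ ?_, ?_, ?_⟩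
  · rw [subst_inX h', subst_inX_eq ha', haa', hinX]
  · rw [subst_mul h', subst_X_one h', subst_inX h', subst_inX_eq ha', mul_assoc, inX, inX,
      ← map_mul, mul_comm (b'.subst a'), hbb, map_one, mul_one]
  · rw [subst_inX h, subst_inX_eq ha, ha'a, hinX]
  · rw [subst_mul h, subst_X_one h, subst_inX h, subst_inX_eq ha,
      PowerSeries.subst_comp_subst_apply hs' hs, ha'a, PowerSeries.X_subst, mul_assoc, inX, inX,
      ← map_mul, hb', map_one, mul_one]
  · rw [substEquiv_apply, subst_X_zero h]
  · rw [substEquiv_apply, subst_X_one h]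

lemma Equivalent.symm {E F : Ser K} (h : Equivalent E F) : Equivalent F E := by
  obtain ⟨φ, hD, hEF⟩ := h
  exact ⟨φ.symm, map_symm_eq hD, map_symm_eq hEF⟩

lemma map_trans (φ ψ : Ser K ≃ₐ[K] Ser K) (I : Ideal (Ser K)) :
    I.map (φ.trans ψ) = (I.map φ).map ψ := by
  ext g
  constructor
  · intro hg
    obtain ⟨a, ha, rfl⟩ := (Ideal.mem_map_iff_of_surjective _ (φ.trans ψ).surjective).mp hg
    exact Ideal.mem_map_of_mem ψ (Ideal.mem_map_of_mem φ ha)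
  · intro hg
    obtain ⟨b, hb, rfl⟩ := (Ideal.mem_map_iff_of_surjective _ ψ.surjective).mp hg
    obtain ⟨a, ha, rfl⟩ := (Ideal.mem_map_iff_of_surjective _ φ.surjective).mp hb
    exact Ideal.mem_map_of_mem (φ.trans ψ) ha

lemma Equivalent.trans {E F G : Ser K} (h : Equivalent E F) (h' : Equivalent F G) :
    Equivalent E G := by
  obtain ⟨φ, hD, hEF⟩ := h
  obtain ⟨ψ, hD', hFG⟩ := h'
  exact ⟨φ.trans ψ, by rw [map_trans, hD, hD'], by rw [map_trans, hEF, hFG]⟩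

lemma equivalent_of_apply_eq {φ : Ser K ≃ₐ[K] Ser K} {E F u v : Ser K} (hu : IsUnit u)
    (hv : IsUnit v) (hX : φ (X 1) = X 1 * u) (hE : φ E = F * v) : Equivalent E F := by
  refine ⟨φ, ?_, ?_⟩
  · rw [idealD, Ideal.map_span, Set.image_singleton, hX]
    exact Ideal.span_singleton_mul_right_unit hu _
  · rw [Ideal.map_span, Set.image_singleton, hE]
    exact Ideal.span_singleton_mul_right_unit hv _

/-- Over an algebraically closed field of characteristic zero, units of `K[[x]]` have roots. -/
lemma exists_pow_eq [IsAlgClosed K] [CharZero K] {N : ℕ} (hN : N ≠ 0) {s : PowerSeries K}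
    (hs : PowerSeries.constantCoeff s ≠ 0) : ∃ α : PowerSeries K, α ^ N = s := by
  obtain ⟨c, t, rfl⟩ := exists_eq_C_add_X_mul s
  have hc : c ≠ 0 := by simpa using hs
  obtain ⟨r, hr⟩ := IsAlgClosed.exists_pow_nat_eq c (Nat.pos_of_ne_zero hN)
  have hbin : PowerSeries.binomialSeries K (1 / N : ℚ) ^ N = 1 + PowerSeries.X := by
    have : ∀ m : ℕ, PowerSeries.binomialSeries K (1 / N : ℚ) ^ m =
        PowerSeries.binomialSeries K (m * (1 / N) : ℚ) := by
      intro m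
      induction m with
      | zero => simp
      | succ m ih =>
        rw [pow_succ, ih, ← PowerSeries.binomialSeries_add]; congr 1; push_cast; ring
    have h1 : ((N : ℚ) * (1 / N)) = (1 : ℕ) := by
      rw [mul_one_div_cancel (by exact_mod_cast hN)]; simp
    rw [this, h1, PowerSeries.binomialSeries_nat, pow_one]
  have hX : PowerSeries.HasSubst (PowerSeries.X * (PowerSeries.C c⁻¹ * t) : PowerSeries K) :=
    powerSeries_hasSubst (by simp)
  refine ⟨PowerSeries.C r *
    (PowerSeries.binomialSeries K (1 / N : ℚ)).subst
      (PowerSeries.X * (PowerSeries.C c⁻¹ * t) : PowerSeries K), ?_⟩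
  have hcc : PowerSeries.C c * PowerSeries.C c⁻¹ = 1 := by
    rw [← map_mul, mul_inv_cancel₀ hc, map_one]
  rw [mul_pow, ← map_pow, hr, ← PowerSeries.subst_pow hX, hbin, ← PowerSeries.coe_substAlgHom hX,
    map_add, map_one, PowerSeries.coe_substAlgHom hX, PowerSeries.subst_X hX]
  linear_combination PowerSeries.X * t * hcc

/-- The normal form of a union of two smooth branches of different contact with `y = 0`. -/
lemma equivalent_normalForm [IsAlgClosed K] [CharZero K] {k n : ℕ} (hkn : k < n)
    {β v : PowerSeries K} (hβ : PowerSeries.constantCoeff β ≠ 0)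
    (hv : PowerSeries.constantCoeff v ≠ 0) {u : Ser K} (hu : IsUnit u) :
    Equivalent ((X 1 + X 0 ^ n * inX β) * (X 1 + X 0 ^ k * inX v) * u)
      ((X 1 + X 0 ^ k) * (X 1 + X 0 ^ n)) := by
  obtain ⟨v', hv'⟩ := (PowerSeries.isUnit_iff_constantCoeff.mpr hv.isUnit).exists_right_inv
  have hv'0 : PowerSeries.constantCoeff v' ≠ 0 := by
    intro h
    have := congrArg PowerSeries.constantCoeff hv'
    rw [map_mul, h, mul_zero, map_one] at this
    exact zero_ne_one this
  -- the equations `α ^ k = b v` and `α ^ n = b β` are solved by a root `α` of `β / v`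
  obtain ⟨α, hα⟩ := exists_pow_eq (N := n - k) (by omega) (s := β * v')
    (by rw [map_mul]; exact mul_ne_zero hβ hv'0)
  have hα0 : PowerSeries.constantCoeff α ≠ 0 := by
    intro h
    have := congrArg PowerSeries.constantCoeff hα
    rw [map_pow, h, zero_pow (by omega), map_mul] at this
    exact mul_ne_zero hβ hv'0 this.symm
  have hb0 : PowerSeries.constantCoeff (α ^ k * v') ≠ 0 := by
    rw [map_mul, map_pow]; exact mul_ne_zero (pow_ne_zero _ hα0) hv'0
  obtain ⟨φ, h0, h1⟩ := exists_rescaling (a := PowerSeries.X * α) (b := α ^ k * v') (by simp)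
    (by rw [PowerSeries.coeff_succ_X_mul 0]; simpa using hα0) hb0
  have hk : α ^ k = α ^ k * v' * v := by linear_combination (-α ^ k) * hv'
  have hn : α ^ n = α ^ k * v' * β := by
    rw [← Nat.add_sub_cancel' hkn.le, pow_add, hα]; ring
  have hbu : IsUnit (inX (α ^ k * v')) := by
    rw [isUnit_iff_constantCoeff, constantCoeff_inX]; exact hb0.isUnit
  obtain ⟨u', hu'⟩ := hu.exists_right_inv
  have hu'u : IsUnit u' := IsUnit.of_mul_eq_one u (by rw [mul_comm, hu'])
  refine (equivalent_of_apply_eq (φ := φ) hbu (hbu.mul hbu |>.mul hu'u) h1 ?_).symm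
  have hx : ∀ m, φ (X 0 ^ m) = X 0 ^ m * inX (α ^ m) := by
    intro m
    rw [map_pow, h0, inX, inX, map_mul, PowerSeries.toMvPowerSeries_X, mul_pow, map_pow]
  rw [map_mul, map_add, map_add, hx, hx, h1, hn]
  nth_rewrite 2 [hk]
  simp only [inX, map_mul]
  linear_combination (-(X 1 + X 0 ^ n * inX β) * (X 1 + X 0 ^ k * inX v) * (inX (α ^ k) * inX v') *
    (inX (α ^ k) * inX v')) * hu'

end CoordinateChanges

/-! ### Restriction to graphs -/

section Graphs

variable {K : Type*} [Field K]

lemma yCoeff_zero_mul (f g : Ser K) : yCoeff 0 (f * g) = yCoeff 0 f * yCoeff 0 g := by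
  conv_lhs => rw [yCoeff_zero_add_yShift f, add_mul, mul_assoc, map_add, yCoeff_inX_mul,
    yCoeff_zero_X_one_mul, add_zero]

/-- Restriction to `y = 0`. -/
noncomputable def restrictD (K : Type*) [Field K] : Ser K →ₐ[K] PowerSeries K :=
  AlgHom.ofLinearMap (yCoeff 0)
    (by have := yCoeff_zero_inX (1 : PowerSeries K); rwa [inX, map_one] at this) yCoeff_zero_mul

lemma restrictD_apply (f : Ser K) : restrictD K f = yCoeff 0 f := rfl

lemma hasSubst_graph {q : PowerSeries K} (hq : PowerSeries.constantCoeff q = 0) :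
    HasSubst ![(X 0 : Ser K), X 1 + inX q] :=
  hasSubst_pair (by simp) (by rw [map_add, constantCoeff_inX, hq]; simp)

/-- Restriction to the graph `y = q(x)`. -/
noncomputable def restrictGraph {q : PowerSeries K} (hq : PowerSeries.constantCoeff q = 0) :
    Ser K →ₐ[K] PowerSeries K :=
  (restrictD K).comp (substAlgHom (hasSubst_graph hq))

lemma restrictGraph_apply {q : PowerSeries K} (hq : PowerSeries.constantCoeff q = 0) (f : Ser K) :
    restrictGraph hq f = yCoeff 0 (subst ![(X 0 : Ser K), X 1 + inX q] f) := by
  rw [restrictGraph, AlgHom.comp_apply, substAlgHom_apply, restrictD_apply]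

lemma restrictGraph_inX {q : PowerSeries K} (hq : PowerSeries.constantCoeff q = 0)
    (p : PowerSeries K) : restrictGraph hq (inX p) = p := by
  rw [restrictGraph_apply, subst_inX (hasSubst_graph hq), subst_X_zero_eq_inX, yCoeff_zero_inX]

lemma restrictGraph_X_one {q : PowerSeries K} (hq : PowerSeries.constantCoeff q = 0) :
    restrictGraph hq (X 1) = q := by
  have := yCoeff_zero_X_one_mul (1 : Ser K)
  rw [mul_one] at this
  rw [restrictGraph_apply, subst_X_one (hasSubst_graph hq), map_add, this, zero_add,
    yCoeff_zero_inX]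

/-- Division by the equation of a graph. -/
lemma exists_eq_inX_add_mul {q : PowerSeries K} (hq : PowerSeries.constantCoeff q = 0)
    (f : Ser K) : ∃ h, f = inX (restrictGraph hq f) + (X 1 - inX q) * h := by
  have hs := hasSubst_graph hq
  have hs' : HasSubst ![(X 0 : Ser K), X 1 - inX q] :=
    hasSubst_pair (by simp) (by rw [map_sub, constantCoeff_inX, hq]; simp)
  refine ⟨subst ![(X 0 : Ser K), X 1 - inX q]
    (yShift (subst ![(X 0 : Ser K), X 1 + inX q] f)), ?_⟩
  have hid : subst ![(X 0 : Ser K), X 1 - inX q] (subst ![(X 0 : Ser K), X 1 + inX q] f) = f := by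
    rw [subst_subst_pair hs hs', subst_X_zero hs', subst_add hs', subst_X_one hs', subst_inX hs',
      subst_X_zero_eq_inX, sub_add_cancel, subst_X_pair]
  conv_lhs => rw [← hid, yCoeff_zero_add_yShift (subst ![(X 0 : Ser K), X 1 + inX q] f),
    subst_add hs', subst_mul hs', subst_X_one hs', subst_inX hs', subst_X_zero_eq_inX]
  rw [restrictGraph_apply]

lemma restrictGraph_eq_zero_iff {q : PowerSeries K} (hq : PowerSeries.constantCoeff q = 0)
    {f : Ser K} : restrictGraph hq f = 0 ↔ X 1 - inX q ∣ f := by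
  constructor
  · intro h
    obtain ⟨g, hg⟩ := exists_eq_inX_add_mul hq f
    rw [h, inX, map_zero, zero_add] at hg
    exact ⟨g, hg⟩
  · rintro ⟨g, rfl⟩
    rw [map_mul, map_sub, restrictGraph_X_one, restrictGraph_inX, sub_self, zero_mul]

lemma X_one_sub_inX_ne_zero (q : PowerSeries K) : (X 1 - inX q : Ser K) ≠ 0 := by
  intro h
  have := congrArg (yCoeff 1) h
  have h1 := yCoeff_succ_X_one_mul 0 (1 : Ser K)
  rw [mul_one] at h1
  have h2 : yCoeff 0 (1 : Ser K) = 1 := map_one (restrictD K)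
  rw [map_sub, yCoeff_inX_succ, sub_zero, map_zero, h1, h2] at this
  exact one_ne_zero this

end Graphs

/-! ### Parametrized branches -/

section Parametrized

variable {K : Type*} [Field K]

lemma constantCoeff_algHom (θ : Ser K →ₐ[K] PowerSeries K) (f : Ser K) :
    PowerSeries.constantCoeff (θ f) = constantCoeff f := by
  by_contra hne
  set e := PowerSeries.constantCoeff (θ f) with he
  -- `f - e` is a unit, but its image is not
  have hC : θ (C e) = PowerSeries.C e := θ.commutes e
  have hu : IsUnit (f - C e) := by
    rw [isUnit_iff_constantCoeff, map_sub, constantCoeff_C]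
    exact (sub_ne_zero.mpr (Ne.symm hne)).isUnit
  have := PowerSeries.isUnit_iff_constantCoeff.mp (hu.map θ)
  rw [map_sub, hC, map_sub, PowerSeries.constantCoeff_C, ← he, sub_self] at this
  exact not_isUnit_zero this

/-- Algebra homomorphisms between rings of power series are continuous. -/
lemma algHom_inX (θ : Ser K →ₐ[K] PowerSeries K) (p : PowerSeries K) :
    θ (inX p) = p.subst (θ (X 0)) := by
  have ha : PowerSeries.constantCoeff (θ (X 0)) = 0 := by rw [constantCoeff_algHom]; simp
  have hs := powerSeries_hasSubst ha
  obtain ⟨a', ha'⟩ := PowerSeries.X_dvd_iff.mpr ha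
  have key : ∀ s : PowerSeries K, s * (θ (inX p) - p.subst (θ (X 0))) = 0 := by
    intro s
    refine eq_zero_of_forall_X_dvd
      (fun i : PowerSeries K × PowerSeries K => i.1 * (θ (inX i.2) - i.2.subst (θ (X 0))))
      (fun i => ?_) (s, p)
    obtain ⟨s, p⟩ := i
    obtain ⟨c, q, rfl⟩ := exists_eq_C_add_X_mul p
    refine ⟨(s * a', q), ?_⟩
    have hC : θ (C c) = PowerSeries.C c := θ.commutes c
    have h1 : θ (inX (PowerSeries.C c + PowerSeries.X * q)) =
        PowerSeries.C c + θ (X 0) * θ (inX q) := by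
      rw [inX, map_add, map_mul, PowerSeries.toMvPowerSeries_C, PowerSeries.toMvPowerSeries_X,
        map_add, map_mul, hC]
    have h2 : (PowerSeries.C c + PowerSeries.X * q).subst (θ (X 0)) =
        PowerSeries.C c + θ (X 0) * q.subst (θ (X 0)) := by
      rw [PowerSeries.subst_add hs, PowerSeries.subst_mul hs, PowerSeries.subst_X hs,
        PowerSeries.subst_C]
      rfl
    simp only [h1, h2]
    linear_combination s * (θ (inX q) - q.subst (θ (X 0))) * ha'
  have := key 1
  rwa [one_mul, sub_eq_zero] at this

lemma X_pow_dvd_subst_iff {a : PowerSeries K} (ha : PowerSeries.constantCoeff a = 0)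
    (ha1 : PowerSeries.coeff 1 a ≠ 0) {m : ℕ} {p : PowerSeries K} :
    PowerSeries.X ^ m ∣ p.subst a ↔ PowerSeries.X ^ m ∣ p := by
  have key : ∀ {b p : PowerSeries K}, PowerSeries.constantCoeff b = 0 →
      PowerSeries.X ^ m ∣ p → PowerSeries.X ^ m ∣ p.subst b := by
    rintro b _ hb ⟨r, rfl⟩
    have hs := powerSeries_hasSubst hb
    rw [PowerSeries.subst_mul hs, PowerSeries.subst_pow hs, PowerSeries.subst_X hs]
    exact (pow_dvd_pow_of_dvd (PowerSeries.X_dvd_iff.mpr hb) m).mul_right _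
  refine ⟨fun h => ?_, key ha⟩
  have h' := key (PowerSeries.constantCoeff_substInvOfIsUnit a ha1.isUnit) h
  rwa [PowerSeries.subst_comp_subst_apply (powerSeries_hasSubst ha)
    (PowerSeries.HasSubst.substInvOfIsUnit a ha1.isUnit),
    PowerSeries.subst_substInvOfIsUnit_right _ ha, PowerSeries.X_subst] at h'

/-- A branch along which `x` is a local parameter is a graph `y = q(x)`. -/
lemma exists_graph {θ : Ser K →ₐ[K] PowerSeries K} (h1 : PowerSeries.coeff 1 (θ (X 0)) ≠ 0) :
    ∃ q : PowerSeries K, PowerSeries.constantCoeff q = 0 ∧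
      ∀ f, θ f = 0 ↔ X 1 - inX q ∣ f := by
  have ha : PowerSeries.constantCoeff (θ (X 0)) = 0 := by rw [constantCoeff_algHom]; simp
  have hb : PowerSeries.constantCoeff (θ (X 1)) = 0 := by rw [constantCoeff_algHom]; simp
  have ha' := PowerSeries.constantCoeff_substInvOfIsUnit (θ (X 0)) h1.isUnit
  have hs := powerSeries_hasSubst ha
  have hs' := powerSeries_hasSubst ha'
  obtain ⟨q, hqdef⟩ : ∃ q : PowerSeries K,
      q = (θ (X 1)).subst ((θ (X 0)).substInvOfIsUnit h1.isUnit) := ⟨_, rfl⟩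
  have hq : PowerSeries.constantCoeff q = 0 := by
    rw [hqdef]
    exact PowerSeries.constantCoeff_subst_eq_zero ha' _ hb
  have hθq : θ (X 1) = q.subst (θ (X 0)) := by
    rw [hqdef, PowerSeries.subst_comp_subst_apply hs' hs,
      PowerSeries.subst_substInvOfIsUnit_left _ ha, PowerSeries.X_subst]
  have hker : θ (X 1 - inX q) = 0 := by rw [map_sub, algHom_inX, hθq, sub_self]
  refine ⟨q, hq, fun f => ⟨fun hf => ?_, ?_⟩⟩
  · obtain ⟨g, hg⟩ := exists_eq_inX_add_mul hq f
    rw [hg, map_add, map_mul, hker, zero_mul, add_zero, algHom_inX] at hf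
    have h0 : restrictGraph hq f = 0 := by
      have := congrArg (PowerSeries.subst ((θ (X 0)).substInvOfIsUnit h1.isUnit)) hf
      rw [PowerSeries.subst_comp_subst_apply hs hs', PowerSeries.subst_substInvOfIsUnit_right _ ha,
        PowerSeries.X_subst, ← PowerSeries.coe_substAlgHom hs', map_zero] at this
      exact this
    exact (restrictGraph_eq_zero_iff hq).mp h0
  · rintro ⟨g, rfl⟩
    rw [map_mul, hker, zero_mul]

end Parametrized

/-! ### The branches of an `A_{2k-1}`-singularity -/

section Branches

variable {K : Type*} [Field K]

/-- Two parametrized smooth branches with contact `k` whose union is `V(E)`. -/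
structure BranchPair (k : ℕ) (E : Ser K) (θ₁ θ₂ : Ser K →ₐ[K] PowerSeries K) : Prop where
  surjective_fst : Function.Surjective θ₁
  surjective_snd : Function.Surjective θ₂
  map_fst : θ₁ E = 0
  map_snd : θ₂ E = 0
  dvd : ∀ f, θ₁ f = 0 → θ₂ f = 0 → E ∣ f
  contact_le : ∀ f, θ₁ f = 0 → PowerSeries.X ^ k ∣ θ₂ f
  contact_ge : ∃ f, θ₁ f = 0 ∧ ¬ PowerSeries.X ^ (k + 1) ∣ θ₂ f

lemma branchPair_model [CharZero K] {k : ℕ} {i : K} (hi : i ^ 2 = -1)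
    (h₁ : PowerSeries.constantCoeff (PowerSeries.C i * PowerSeries.X ^ k) = 0)
    (h₂ : PowerSeries.constantCoeff (PowerSeries.C (-i) * PowerSeries.X ^ k) = 0) :
    BranchPair k (X 1 ^ 2 + X 0 ^ (2 * k) : Ser K) (restrictGraph h₁) (restrictGraph h₂) := by
  have hi0 : i ≠ 0 := by rintro rfl; norm_num at hi
  have hfac : (X 1 ^ 2 + X 0 ^ (2 * k) : Ser K) =
      (X 1 - inX (PowerSeries.C i * PowerSeries.X ^ k)) *
        (X 1 - inX (PowerSeries.C (-i) * PowerSeries.X ^ k)) := by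
    have hC : (C i : Ser K) * C i = -1 := by rw [← map_mul, ← pow_two, hi, map_neg, map_one]
    simp only [inX, map_mul, map_pow, PowerSeries.toMvPowerSeries_C,
      PowerSeries.toMvPowerSeries_X, map_neg]
    linear_combination X 0 ^ (2 * k) * hC
  have hval : restrictGraph h₂ (X 1 - inX (PowerSeries.C i * PowerSeries.X ^ k)) =
      PowerSeries.X ^ k * PowerSeries.C (-2 * i) := by
    rw [map_sub, restrictGraph_X_one, restrictGraph_inX]
    simp only [map_neg, map_mul, map_ofNat]; ring
  have h2i : -2 * i ≠ 0 := mul_ne_zero (by norm_num) hi0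
  refine ⟨fun p => ⟨_, restrictGraph_inX h₁ p⟩, fun p => ⟨_, restrictGraph_inX h₂ p⟩,
    (restrictGraph_eq_zero_iff h₁).mpr ⟨_, hfac⟩,
    (restrictGraph_eq_zero_iff h₂).mpr ⟨_, by rw [hfac, mul_comm]⟩, ?_, ?_, ?_⟩
  · intro f hf1 hf2
    obtain ⟨g, rfl⟩ := (restrictGraph_eq_zero_iff h₁).mp hf1
    rw [map_mul, hval] at hf2
    have hne : PowerSeries.X ^ k * PowerSeries.C (-2 * i) ≠ 0 :=
      mul_ne_zero (pow_ne_zero _ PowerSeries.X_ne_zero)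
        (by rw [Ne, map_eq_zero_iff _ PowerSeries.C_injective]; exact h2i)
    rw [hfac]
    exact mul_dvd_mul_left _
      ((restrictGraph_eq_zero_iff h₂).mp ((mul_eq_zero.mp hf2).resolve_left hne))
  · intro f hf1
    obtain ⟨g, rfl⟩ := (restrictGraph_eq_zero_iff h₁).mp hf1
    rw [map_mul, hval, mul_assoc]
    exact dvd_mul_right _ _
  · refine ⟨_, (restrictGraph_eq_zero_iff h₁).mpr dvd_rfl, ?_⟩
    rw [hval, PowerSeries.X_pow_dvd_iff]
    intro h
    have := h k (by omega)
    rw [PowerSeries.coeff_X_pow_mul', if_pos le_rfl, Nat.sub_self, PowerSeries.coeff_zero_C] at this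
    exact h2i this

/-- The branches of the model, transported to the singularity. -/
lemma IsAOdd.exists_branchPair [IsAlgClosed K] [CharZero K] {k : ℕ} (hk : 1 ≤ k) {E : Ser K}
    (h : IsAOdd k E) : ∃ θ₁ θ₂, BranchPair k E θ₁ θ₂ := by
  obtain ⟨ψ⟩ := h
  obtain ⟨i, hi⟩ := IsAlgClosed.exists_pow_nat_eq (-1 : K) (n := 2) (by norm_num)
  have hcc : ∀ c : K, PowerSeries.constantCoeff (PowerSeries.C c * PowerSeries.X ^ k) = 0 := by
    intro c
    rw [map_mul, map_pow, PowerSeries.constantCoeff_X, zero_pow (by omega), mul_zero]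
  have hB := branchPair_model hi (hcc i) (hcc (-i))
  set E₀ : Ser K := X 1 ^ 2 + X 0 ^ (2 * k)
  set ρ₁ := restrictGraph (hcc i)
  set ρ₂ := restrictGraph (hcc (-i))
  have hker : ∀ ρ : Ser K →ₐ[K] PowerSeries K, ρ E₀ = 0 → ∀ a ∈ Ideal.span {E₀}, ρ a = 0 := by
    intro ρ hρ a ha
    obtain ⟨t, rfl⟩ := Ideal.mem_span_singleton'.mp ha
    rw [map_mul, hρ, mul_zero]
  let π₁ := (Ideal.Quotient.liftₐ (Ideal.span {E₀}) ρ₁ (hker ρ₁ hB.map_fst)).comp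
    (ψ.toAlgHom.comp (Ideal.Quotient.mkₐ K (Ideal.span {E})))
  let π₂ := (Ideal.Quotient.liftₐ (Ideal.span {E₀}) ρ₂ (hker ρ₂ hB.map_snd)).comp
    (ψ.toAlgHom.comp (Ideal.Quotient.mkₐ K (Ideal.span {E})))
  have h₁ : ∀ f g, ψ (Ideal.Quotient.mk _ f) = Ideal.Quotient.mk _ g → π₁ f = ρ₁ g := by
    intro f g hfg
    change Ideal.Quotient.liftₐ (Ideal.span {E₀}) ρ₁ (hker ρ₁ hB.map_fst)
      (ψ (Ideal.Quotient.mk _ f)) = _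
    rw [hfg]; rfl
  have h₂ : ∀ f g, ψ (Ideal.Quotient.mk _ f) = Ideal.Quotient.mk _ g → π₂ f = ρ₂ g := by
    intro f g hfg
    change Ideal.Quotient.liftₐ (Ideal.span {E₀}) ρ₂ (hker ρ₂ hB.map_snd)
      (ψ (Ideal.Quotient.mk _ f)) = _
    rw [hfg]; rfl
  have hlift : ∀ f, ∃ g, ψ (Ideal.Quotient.mk _ f) = Ideal.Quotient.mk (Ideal.span {E₀}) g := by
    intro f
    obtain ⟨g, hg⟩ := Ideal.Quotient.mk_surjective (ψ (Ideal.Quotient.mk _ f))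
    exact ⟨g, hg.symm⟩
  have hlift' : ∀ g, ∃ f, ψ (Ideal.Quotient.mk _ f) = Ideal.Quotient.mk (Ideal.span {E₀}) g := by
    intro g
    obtain ⟨f, hf⟩ := Ideal.Quotient.mk_surjective (ψ.symm (Ideal.Quotient.mk _ g))
    exact ⟨f, by rw [hf, AlgEquiv.apply_symm_apply]⟩
  have hE : ψ (Ideal.Quotient.mk _ E) = Ideal.Quotient.mk (Ideal.span {E₀}) 0 := by
    rw [Ideal.Quotient.eq_zero_iff_mem.mpr (Ideal.mem_span_singleton_self E), map_zero,
      map_zero]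
  refine ⟨π₁, π₂, ?_, ?_, ?_, ?_, ?_, ?_, ?_⟩
  · intro p
    obtain ⟨g, rfl⟩ := hB.surjective_fst p
    exact (hlift' g).imp fun f hf => h₁ f g hf
  · intro p
    obtain ⟨g, rfl⟩ := hB.surjective_snd p
    exact (hlift' g).imp fun f hf => h₂ f g hf
  · rw [h₁ E 0 hE, map_zero]
  · rw [h₂ E 0 hE, map_zero]
  · intro f hf1 hf2
    obtain ⟨g, hg⟩ := hlift f
    rw [h₁ f g hg] at hf1
    rw [h₂ f g hg] at hf2
    have hg0 : Ideal.Quotient.mk (Ideal.span {E₀}) g = 0 :=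
      Ideal.Quotient.eq_zero_iff_mem.mpr (Ideal.mem_span_singleton.mpr (hB.dvd g hf1 hf2))
    rw [hg0, EmbeddingLike.map_eq_zero_iff, Ideal.Quotient.eq_zero_iff_mem,
      Ideal.mem_span_singleton] at hg
    exact hg
  · intro f hf
    obtain ⟨g, hg⟩ := hlift f
    rw [h₁ f g hg] at hf
    rw [h₂ f g hg]
    exact hB.contact_le g hf
  · obtain ⟨g, hg1, hg2⟩ := hB.contact_ge
    obtain ⟨f, hf⟩ := hlift' g
    exact ⟨f, by rwa [h₁ f g hf], by rwa [h₂ f g hf]⟩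

/-- Two branches along both of which `x` is a local parameter are graphs. -/
lemma BranchPair.exists_factorization {k : ℕ} {E : Ser K} {θ₁ θ₂ : Ser K →ₐ[K] PowerSeries K}
    (h : BranchPair k E θ₁ θ₂) (h₁ : PowerSeries.coeff 1 (θ₁ (X 0)) ≠ 0)
    (h₂ : PowerSeries.coeff 1 (θ₂ (X 0)) ≠ 0) :
    ∃ (q₁ q₂ : PowerSeries K) (u : Ser K), IsUnit u ∧
      E = (X 1 - inX q₁) * (X 1 - inX q₂) * u ∧
      PowerSeries.X ^ k ∣ q₂ - q₁ ∧ ¬ PowerSeries.X ^ (k + 1) ∣ q₂ - q₁ := by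
  obtain ⟨q₁, -, hker₁⟩ := exists_graph h₁
  obtain ⟨q₂, -, hker₂⟩ := exists_graph h₂
  have ha : PowerSeries.constantCoeff (θ₂ (X 0)) = 0 := by rw [constantCoeff_algHom]; simp
  have hval : θ₂ (X 1 - inX q₁) = (q₂ - q₁).subst (θ₂ (X 0)) := by
    have h0 := (hker₂ _).mpr dvd_rfl
    rw [map_sub, algHom_inX] at h0
    rw [map_sub, algHom_inX, PowerSeries.subst_sub (powerSeries_hasSubst ha)]
    linear_combination h0
  obtain ⟨g, hg1, hg2⟩ := h.contact_ge
  obtain ⟨g', rfl⟩ := (hker₁ g).mp hg1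
  rw [map_mul] at hg2
  have hne : θ₂ (X 1 - inX q₁) ≠ 0 := by
    intro h0
    rw [h0, zero_mul] at hg2
    exact hg2 (dvd_zero _)
  have hprod : E ∣ (X 1 - inX q₁) * (X 1 - inX q₂) :=
    h.dvd _ ((hker₁ _).mpr (dvd_mul_right _ _)) ((hker₂ _).mpr (dvd_mul_left _ _))
  obtain ⟨e, he⟩ := (hker₁ E).mp h.map_fst
  have he2 := h.map_snd
  rw [he, map_mul] at he2
  obtain ⟨u, rfl⟩ := (hker₂ e).mp ((mul_eq_zero.mp he2).resolve_left hne)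
  rw [← mul_assoc] at he
  refine ⟨q₁, q₂, u, ?_, he, ?_, ?_⟩
  · obtain ⟨t, ht⟩ := hprod
    have hne' : (X 1 - inX q₁) * (X 1 - inX q₂) ≠ 0 :=
      mul_ne_zero (X_one_sub_inX_ne_zero q₁) (X_one_sub_inX_ne_zero q₂)
    refine IsUnit.of_mul_eq_one t (mul_left_cancel₀ hne' ?_)
    rw [← mul_assoc, ← he, ← ht, mul_one]
  · have := h.contact_le _ ((hker₁ _).mpr dvd_rfl)
    rwa [hval, X_pow_dvd_subst_iff ha h₂] at this
  · intro hk
    refine hg2 (Dvd.dvd.mul_right ?_ _)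
    rwa [hval, X_pow_dvd_subst_iff ha h₂]

/-- The linear terms of a parametrization do not both vanish. -/
lemma coeff_one_ne_zero_of_surjective {θ : Ser K →ₐ[K] PowerSeries K}
    (h : Function.Surjective θ) :
    PowerSeries.coeff 1 (θ (X 0)) ≠ 0 ∨ PowerSeries.coeff 1 (θ (X 1)) ≠ 0 := by
  by_contra! hcon
  obtain ⟨f, hf⟩ := h PowerSeries.X
  obtain ⟨c, q, hc⟩ := exists_eq_C_add_X_mul (yCoeff 0 f)
  have hdec : f = C c + X 0 * inX q + X 1 * yShift f := by
    conv_lhs => rw [yCoeff_zero_add_yShift f, hc]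
    simp [inX]
  have hcc : ∀ s, PowerSeries.constantCoeff (θ (X s)) = 0 := fun s => by
    rw [constantCoeff_algHom]; simp
  have hmul : ∀ s g, PowerSeries.coeff 1 (θ (X s)) = 0 → PowerSeries.coeff 1 (θ (X s * g)) = 0 := by
    intro s g hs
    have hX2 : PowerSeries.X ^ 2 ∣ θ (X s) := by
      rw [PowerSeries.X_pow_dvd_iff]
      intro m hm
      interval_cases m
      · simpa using hcc s
      · exact hs
    rw [map_mul]
    exact PowerSeries.X_pow_dvd_iff.mp (hX2.mul_right _) 1 (by omega)
  have hC : θ (C c) = PowerSeries.C c := θ.commutes c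
  have := congrArg (PowerSeries.coeff 1) hf
  rw [hdec, map_add, map_add, map_add, map_add, hmul 0 _ hcon.1, hmul 1 _ hcon.2, hC,
    PowerSeries.coeff_one_X] at this
  simp at this

/-- A generic linear combination avoids two linear conditions. -/
lemma exists_add_mul_ne_zero [Infinite K] {a b a' b' : K} (h : a ≠ 0 ∨ b ≠ 0)
    (h' : a' ≠ 0 ∨ b' ≠ 0) : ∃ c : K, a + c * b ≠ 0 ∧ a' + c * b' ≠ 0 := by
  by_contra! hcon
  have hp : (Polynomial.C a + Polynomial.X * Polynomial.C b) *
      (Polynomial.C a' + Polynomial.X * Polynomial.C b') = 0 := by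
    refine Polynomial.funext fun c => ?_
    simp only [Polynomial.eval_mul, Polynomial.eval_add, Polynomial.eval_C, Polynomial.eval_X,
      Polynomial.eval_zero]
    by_cases hc : a + c * b = 0
    · rw [hc, zero_mul]
    · rw [hcon c hc, mul_zero]
  have hlin : ∀ x y : K, Polynomial.C x + Polynomial.X * Polynomial.C y = 0 → x = 0 ∧ y = 0 := by
    intro x y hxy
    have h0 := congrArg (fun p => Polynomial.coeff p 0) hxy
    have h1 := congrArg (fun p => Polynomial.coeff p 1) hxy
    simp [Polynomial.coeff_C] at h0 h1
    exact ⟨h0, h1⟩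
  rcases mul_eq_zero.mp hp with h0 | h0
  · obtain ⟨rfl, rfl⟩ := hlin _ _ h0; simp at h
  · obtain ⟨rfl, rfl⟩ := hlin _ _ h0; simp at h'

end Branches

/-! ### Contact with `y = 0` -/

section Contact

variable {K : Type*} [Field K]

lemma exists_eq_X_pow_mul {p : PowerSeries K} (hp : p ≠ 0) :
    ∃ (d : ℕ) (u : PowerSeries K), PowerSeries.constantCoeff u ≠ 0 ∧ p = PowerSeries.X ^ d * u :=
  ⟨p.order.toNat, PowerSeries.divXPowOrder p,
    (PowerSeries.isUnit_iff_constantCoeff.mp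
      (PowerSeries.isUnit_divided_by_X_pow_order hp)).ne_zero,
    PowerSeries.X_pow_order_mul_divXPowOrder.symm⟩

lemma X_pow_dvd_X_pow_mul_iff {m d : ℕ} {u : PowerSeries K}
    (hu : PowerSeries.constantCoeff u ≠ 0) :
    PowerSeries.X ^ m ∣ PowerSeries.X ^ d * u ↔ m ≤ d := by
  constructor
  · intro h
    by_contra! hlt
    have := PowerSeries.X_pow_dvd_iff.mp h d hlt
    rw [PowerSeries.coeff_X_pow_mul', if_pos le_rfl, Nat.sub_self,
      PowerSeries.coeff_zero_eq_constantCoeff_apply] at this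
    exact hu this
  · intro h
    exact (pow_dvd_pow _ h).mul_right _

lemma eq_of_X_pow_mul_eq {d e : ℕ} {u v : PowerSeries K} (hu : PowerSeries.constantCoeff u ≠ 0)
    (hv : PowerSeries.constantCoeff v ≠ 0)
    (h : PowerSeries.X ^ d * u = PowerSeries.X ^ e * v) : d = e :=
  le_antisymm ((X_pow_dvd_X_pow_mul_iff hv).mp (h ▸ dvd_mul_right _ _))
    ((X_pow_dvd_X_pow_mul_iff hu).mp (h ▸ dvd_mul_right _ _))

lemma mem_span_sup_idealD {E f : Ser K} :
    f ∈ Ideal.span {E} ⊔ idealD K ↔ yCoeff 0 E ∣ yCoeff 0 f := by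
  rw [idealD, ← Ideal.span_union, Set.singleton_union, Ideal.mem_span_pair]
  constructor
  · rintro ⟨a, b, rfl⟩
    rw [map_add, mul_comm b, yCoeff_zero_X_one_mul, add_zero, yCoeff_zero_mul]
    exact dvd_mul_left _ _
  · rintro ⟨t, ht⟩
    refine ⟨inX t, yShift f - inX t * yShift E, ?_⟩
    conv_rhs => rw [yCoeff_zero_add_yShift f, ht]
    conv_lhs => enter [1]; rw [yCoeff_zero_add_yShift E]
    simp only [inX, map_mul]
    ring

/-- A curve with finite positive intersection number `d` with `y = 0` restricts to a series of
order `d`. A curve that contains `y = 0` is excluded by the convention that its intersection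
number is `0`. -/
lemma exists_yCoeff_zero_eq {E : Ser K} {w : ℕ} (hw : interD E = w) (hw0 : w ≠ 0) :
    ∃ s, PowerSeries.constantCoeff s ≠ 0 ∧ yCoeff 0 E = PowerSeries.X ^ w * s := by
  by_cases h0 : yCoeff 0 E = 0
  · exfalso
    have hfin : Module.Finite K (Ser K ⧸ (Ideal.span {E} ⊔ idealD K)) := by
      by_contra hinf
      exact hw0 (hw ▸ Module.finrank_of_not_finite hinf)
    -- the quotient maps onto `K[[x, y]] / ⟨y, x ^ N⟩` for every `N`
    have hle : Ideal.span {E} ⊔ idealD K ≤ Ideal.span {X 1, X 0 ^ (w + 1)} := by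
      intro f hf
      rw [mem_span_sup_idealD, h0, zero_dvd_iff] at hf
      rw [mem_span_X_one_X_zero_pow, hf]
      exact dvd_zero _
    have := LinearMap.finrank_le_finrank_of_surjective
      (f := (Ideal.Quotient.factorₐ K hle).toLinearMap) (Ideal.Quotient.factor_surjective hle)
    rw [finrank_quotient_span_X_one_X_zero_pow] at this
    change w + 1 ≤ interD E at this
    omega
  · obtain ⟨d, s, hs, hd⟩ := exists_eq_X_pow_mul h0
    obtain ⟨s', hs'⟩ := (PowerSeries.isUnit_iff_constantCoeff.mpr hs.isUnit).exists_right_inv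
    have hideal : Ideal.span {E} ⊔ idealD K = Ideal.span {X 1, X 0 ^ d} := by
      ext f
      rw [mem_span_sup_idealD, mem_span_X_one_X_zero_pow, hd]
      exact (PowerSeries.isUnit_iff_constantCoeff.mpr hs.isUnit).mul_right_dvd
    rw [interD, hideal, finrank_quotient_span_X_one_X_zero_pow] at hw
    exact ⟨s, hs, hw ▸ hd⟩

/-- Two branches with contact `k` whose contacts with `y = 0` have the sum `w > 2k`: the branches
have contact `k` and `w - k` with `y = 0`. -/
lemma exists_eq_branches {k w : ℕ} (hkw : 2 * k < w) {q₁ q₂ : PowerSeries K} {u : Ser K}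
    (hu : IsUnit u) (hdvd : PowerSeries.X ^ k ∣ q₂ - q₁)
    (hndvd : ¬ PowerSeries.X ^ (k + 1) ∣ q₂ - q₁) {s : PowerSeries K}
    (hs : PowerSeries.constantCoeff s ≠ 0)
    (hw : yCoeff 0 ((X 1 - inX q₁) * (X 1 - inX q₂) * u) = PowerSeries.X ^ w * s) :
    ∃ β v : PowerSeries K, PowerSeries.constantCoeff β ≠ 0 ∧ PowerSeries.constantCoeff v ≠ 0 ∧
      (X 1 - inX q₁) * (X 1 - inX q₂) * u =
        (X 1 + X 0 ^ (w - k) * inX β) * (X 1 + X 0 ^ k * inX v) * u := by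
  have hy : ∀ q : PowerSeries K, yCoeff 0 (X 1 - inX q) = -q := fun q => by
    have := yCoeff_zero_X_one_mul (1 : Ser K)
    rw [mul_one] at this
    rw [map_sub, this, yCoeff_zero_inX, zero_sub]
  have hu0 : PowerSeries.constantCoeff (yCoeff 0 u) ≠ 0 := by
    rw [← constantCoeff_eq_yCoeff]; exact (isUnit_iff_constantCoeff.mp hu).ne_zero
  rw [yCoeff_zero_mul, yCoeff_zero_mul, hy, hy, neg_mul_neg] at hw
  have hs0 : PowerSeries.X ^ w * s ≠ 0 :=
    mul_ne_zero (pow_ne_zero _ PowerSeries.X_ne_zero) fun h => hs (by rw [h, map_zero])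
  have hq₁ : q₁ ≠ 0 := by rintro rfl; rw [zero_mul, zero_mul] at hw; exact hs0 hw.symm
  have hq₂ : q₂ ≠ 0 := by rintro rfl; rw [mul_zero, zero_mul] at hw; exact hs0 hw.symm
  obtain ⟨d, u₁, hu₁, rfl⟩ := exists_eq_X_pow_mul hq₁
  obtain ⟨e, u₂, hu₂, rfl⟩ := exists_eq_X_pow_mul hq₂
  have hsum : d + e = w := by
    refine eq_of_X_pow_mul_eq (u := u₁ * u₂ * yCoeff 0 u) ?_ hs (by rw [← hw, pow_add]; ring)
    rw [map_mul, map_mul]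
    exact mul_ne_zero (mul_ne_zero hu₁ hu₂) hu0
  -- the contact of two branches is the smaller of two different contacts with `y = 0`
  have key : ∀ {a b : ℕ} {p r : PowerSeries K}, PowerSeries.constantCoeff p ≠ 0 → a < b →
      (∀ m, PowerSeries.X ^ m ∣ PowerSeries.X ^ a * p - PowerSeries.X ^ b * r ↔ m ≤ a) := by
    intro a b p r hp hab m
    obtain ⟨c, rfl⟩ := Nat.exists_eq_add_of_lt hab
    have : PowerSeries.X ^ a * p - PowerSeries.X ^ (a + c + 1) * r =
        PowerSeries.X ^ a * (p - PowerSeries.X * (PowerSeries.X ^ c * r)) := by ring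
    rw [this, X_pow_dvd_X_pow_mul_iff (by simpa using hp)]
  have hinX : ∀ (m : ℕ) (p : PowerSeries K),
      (X 1 - inX (PowerSeries.X ^ m * p) : Ser K) = X 1 + X 0 ^ m * inX (-p) := fun m p => by
    simp only [inX, map_mul, map_pow, PowerSeries.toMvPowerSeries_X, map_neg]; ring
  rcases lt_trichotomy d e with h | rfl | h
  · rw [dvd_sub_comm, key hu₁ h] at hdvd hndvd
    obtain rfl : d = k := by omega
    obtain rfl : e = w - d := by omega
    refine ⟨-u₂, -u₁, by rwa [map_neg, neg_ne_zero], by rwa [map_neg, neg_ne_zero], ?_⟩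
    rw [hinX, hinX]; ring
  · have : d ≤ k := by
      by_contra! hlt
      refine hndvd (dvd_sub ?_ ?_) <;> rwa [X_pow_dvd_X_pow_mul_iff (by assumption)]
    omega
  · rw [key hu₂ h] at hdvd hndvd
    obtain rfl : e = k := by omega
    obtain rfl : d = w - e := by omega
    refine ⟨-u₁, -u₂, by rwa [map_neg, neg_ne_zero], by rwa [map_neg, neg_ne_zero], ?_⟩
    rw [hinX, hinX]

end Contact

/-! ### The normal form and the Newton polygon of `yE` -/

section NormalForm

variable {K : Type*} [Field K]

lemma branchType_of_eq {k n : ℕ} (hkn : k < n) {E a b c : Ser K}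
    (ha : 2 ≤ k → constantCoeff a ≠ 0) (hb : constantCoeff b ≠ 0) (hc : constantCoeff c ≠ 0)
    (hE : E = X 1 ^ 2 * a + X 1 * (X 0 ^ k * b) + X 0 ^ (k + n) * c) :
    BranchType k n (X 1 * E) := by
  rw [constantCoeff_eq_yCoeff] at hb hc
  have hn : PowerSeries.constantCoeff (PowerSeries.X ^ n : PowerSeries K) = 0 := by
    rw [map_pow, PowerSeries.constantCoeff_X, zero_pow (by omega)]
  have h0 : yCoeff 0 E = PowerSeries.X ^ (k + n) * yCoeff 0 c := by
    rw [hE, map_add, map_add, yCoeff_X_one_pow_mul_of_lt (by omega), yCoeff_zero_X_one_mul,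
      yCoeff_X_zero_pow_mul, zero_add, zero_add]
  have h1 : yCoeff 1 E = PowerSeries.X ^ k * (yCoeff 0 b + PowerSeries.X ^ n * yCoeff 1 c) := by
    rw [hE, map_add, map_add, yCoeff_X_one_pow_mul_of_lt (by omega), yCoeff_succ_X_one_mul 0,
      yCoeff_X_zero_pow_mul, yCoeff_X_zero_pow_mul, zero_add]
    ring
  have h2 : yCoeff 2 E =
      yCoeff 0 a + PowerSeries.X ^ k * (yCoeff 1 b + PowerSeries.X ^ n * yCoeff 2 c) := by
    rw [hE, map_add, map_add, yCoeff_X_one_pow_mul_add 0 2, yCoeff_succ_X_one_mul 1,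
      yCoeff_X_zero_pow_mul, yCoeff_X_zero_pow_mul]
    ring
  refine ⟨yCoeff_zero_X_one_mul _, ⟨_, hc, ?_⟩,
    ⟨yCoeff 0 b + PowerSeries.X ^ n * yCoeff 1 c, ?_, ?_⟩, fun hk2 => ?_⟩
  · rw [yCoeff_succ_X_one_mul 0, h0]
  · rwa [map_add, map_mul, hn, zero_mul, add_zero]
  · rw [yCoeff_succ_X_one_mul 1, h1]
  · rw [yCoeff_succ_X_one_mul 2, h2, map_add, map_mul, map_pow, PowerSeries.constantCoeff_X,
      zero_pow (by omega), zero_mul, add_zero, ← constantCoeff_eq_yCoeff]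
    exact ha hk2

lemma branchType_normalForm {k n : ℕ} (hkn : k < n) :
    BranchType k n (X 1 * ((X 1 + X 0 ^ k) * (X 1 + X 0 ^ n)) : Ser K) := by
  refine branchType_of_eq hkn (a := 1) (b := 1 + X 0 ^ (n - k)) (c := 1) (by simp)
    (by simp [show n - k ≠ 0 by omega]) (by simp) ?_
  obtain ⟨d, rfl⟩ := Nat.exists_eq_add_of_lt hkn
  rw [show k + d + 1 - k = d + 1 by omega]
  ring

lemma exists_sheared_pow (c : K) (m : ℕ) : ∃ z : Ser K,
    (2 ≤ m → constantCoeff z = 0) ∧ (X 0 + C c * X 1) ^ m = X 0 ^ m + X 1 * z := by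
  have hdvd : ∀ l, ∃ z : Ser K, (X 0 + C c * X 1) ^ l = X 0 ^ l + X 1 * z := by
    intro l
    obtain ⟨z, hz⟩ := sub_dvd_pow_sub_pow (X 0 + C c * X 1 : Ser K) (X 0) l
    exact ⟨C c * z, by linear_combination hz⟩
  by_cases hm : 2 ≤ m
  · obtain ⟨l, rfl⟩ : ∃ l, m = l + 1 + 1 := ⟨m - 2, by omega⟩
    obtain ⟨z, hz⟩ := hdvd (l + 1)
    refine ⟨z * (X 0 + C c * X 1) + C c * X 0 ^ (l + 1), fun _ => by simp, ?_⟩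
    rw [pow_succ, hz]; ring
  · exact (hdvd m).imp fun z hz => ⟨fun h => absurd h hm, hz⟩

/-- The Newton polygon of a union of two branches is not changed by a shear `x ↦ x + c y`. -/
lemma branchType_sheared {k n : ℕ} (hk : 1 ≤ k) (hkn : k < n) (c : K) {b v u : Ser K}
    (hb : constantCoeff b ≠ 0) (hv : constantCoeff v ≠ 0) (hu : constantCoeff u ≠ 0) :
    BranchType k n (X 1 * ((X 1 + (X 0 + C c * X 1) ^ n * b) *
      (X 1 + (X 0 + C c * X 1) ^ k * v) * u)) := by
  obtain ⟨z, hz, ez⟩ := exists_sheared_pow c n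
  obtain ⟨z', hz', ez'⟩ := exists_sheared_pow c k
  obtain ⟨d, rfl⟩ := Nat.exists_eq_add_of_lt hkn
  specialize hz (by omega)
  refine branchType_of_eq hkn (a := (1 + z * b) * (1 + z' * v) * u)
    (b := ((1 + z * b) * v + X 0 ^ (d + 1) * b * (1 + z' * v)) * u) (c := b * v * u)
    (fun hk2 => ?_) ?_ ?_ ?_
  · simpa [hz, hz' hk2] using hu
  · simpa [hz] using ⟨hv, hu⟩
  · simpa [and_assoc] using ⟨hb, hv, hu⟩
  · rw [ez, ez']; ring

/-- Precomposition of the parametrizations with a coordinate change. -/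
lemma BranchPair.comp {k : ℕ} {E : Ser K} {θ₁ θ₂ : Ser K →ₐ[K] PowerSeries K}
    (h : BranchPair k E θ₁ θ₂) (φ : Ser K ≃ₐ[K] Ser K) :
    BranchPair k (φ.symm E) (θ₁.comp φ) (θ₂.comp φ) where
  surjective_fst := h.surjective_fst.comp φ.surjective
  surjective_snd := h.surjective_snd.comp φ.surjective
  map_fst := by simpa using h.map_fst
  map_snd := by simpa using h.map_snd
  dvd f h1 h2 := by
    have := map_dvd φ.symm (h.dvd (φ f) h1 h2)
    rwa [AlgEquiv.symm_apply_apply] at this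
  contact_le f h1 := h.contact_le (φ f) h1
  contact_ge := by
    obtain ⟨f, h1, h2⟩ := h.contact_ge
    exact ⟨φ.symm f, by simpa using h1, by simpa using h2⟩

/-- An automorphism that is the identity on `y = 0` does not change restrictions to `y = 0`. -/
lemma yCoeff_zero_algEquiv {φ : Ser K ≃ₐ[K] Ser K} (h0 : yCoeff 0 (φ (X 0)) = PowerSeries.X)
    (h1 : yCoeff 0 (φ (X 1)) = 0) (f : Ser K) : yCoeff 0 (φ f) = yCoeff 0 f := by
  have hθ : ∀ g, (restrictD K).comp (φ : Ser K →ₐ[K] Ser K) g = yCoeff 0 (φ g) := fun g => rfl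
  rw [← hθ]
  conv_lhs => rw [yCoeff_zero_add_yShift f, map_add, map_mul, algHom_inX, hθ, hθ, h0, h1,
    PowerSeries.X_subst, zero_mul, add_zero]

/-- An `A_{2k-1}`-singularity that meets `y = 0` with multiplicity `w > 2k` is, up to a shear, the
union of two graphs of contact `w - k` and `k` with `y = 0`. -/
lemma IsAOdd.exists_sheared_eq [IsAlgClosed K] [CharZero K] {k w : ℕ} (hk : 1 ≤ k) {E : Ser K}
    (hE : IsAOdd k E) (hw : interD E = w) (hkw : 2 * k < w) :
    ∃ (c : K) (φ : Ser K ≃ₐ[K] Ser K) (β v : PowerSeries K) (u : Ser K),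
      φ (X 0) = X 0 + C c * X 1 ∧ φ (X 1) = X 1 ∧ PowerSeries.constantCoeff β ≠ 0 ∧
      PowerSeries.constantCoeff v ≠ 0 ∧ IsUnit u ∧
      E = φ ((X 1 + X 0 ^ (w - k) * inX β) * (X 1 + X 0 ^ k * inX v) * u) := by
  obtain ⟨θ₁, θ₂, hθ⟩ := hE.exists_branchPair hk
  -- after a generic shear, `x` is a local parameter on both branches
  obtain ⟨c, hc₁, hc₂⟩ := exists_add_mul_ne_zero
    (coeff_one_ne_zero_of_surjective hθ.surjective_fst)
    (coeff_one_ne_zero_of_surjective hθ.surjective_snd)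
  obtain ⟨φ, hφ0, hφ1⟩ := exists_shear c
  have hcoeff : ∀ θ : Ser K →ₐ[K] PowerSeries K,
      PowerSeries.coeff 1 (θ.comp (φ : Ser K →ₐ[K] Ser K) (X 0)) =
        PowerSeries.coeff 1 (θ (X 0)) + c * PowerSeries.coeff 1 (θ (X 1)) := by
    intro θ
    have hC : θ (C c) = PowerSeries.C c := θ.commutes c
    change PowerSeries.coeff 1 (θ (φ (X 0))) = _
    rw [hφ0, map_add, map_mul, hC, map_add, PowerSeries.coeff_C_mul]
  obtain ⟨q₁, q₂, u, hu, hfac, hdvd, hndvd⟩ := (hθ.comp φ).exists_factorization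
    (by rwa [hcoeff]) (by rwa [hcoeff])
  have hX1 : yCoeff 0 (X 1 : Ser K) = 0 := by
    simpa using yCoeff_zero_X_one_mul (1 : Ser K)
  have hX0 : yCoeff 0 (X 0 : Ser K) = PowerSeries.X := by
    have := yCoeff_zero_inX (PowerSeries.X : PowerSeries K)
    rwa [inX, PowerSeries.toMvPowerSeries_X] at this
  obtain ⟨s, hs, hsE⟩ := exists_yCoeff_zero_eq hw (by omega)
  have hEφ : yCoeff 0 (φ.symm E) = yCoeff 0 E := by
    have := yCoeff_zero_algEquiv (φ := φ)
      (by rw [hφ0, map_add, mul_comm, yCoeff_zero_X_one_mul, add_zero, hX0])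
      (by rw [hφ1, hX1]) (φ.symm E)
    rw [← this, AlgEquiv.apply_symm_apply]
  rw [← hEφ, hfac] at hsE
  obtain ⟨β, v, hβ, hv, heq⟩ := exists_eq_branches hkw hu hdvd hndvd hs hsE
  exact ⟨c, φ, β, v, u, hφ0, hφ1, hβ, hv, hu, by
    rw [← heq, ← hfac, AlgEquiv.apply_symm_apply]⟩

end NormalForm

end LogCurve

theorem mainTheorem7 {K : Type*} [Field K] [IsAlgClosed K] [CharZero K]
    (k w : ℕ) (hk : 1 ≤ k)
    (E : LogCurve.Ser K) (hE : LogCurve.IsAOdd k E)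
    (hw : LogCurve.interD E = w) (hkw : 2 * k < w)
    (F : LogCurve.Ser K)
    (hF : F = (MvPowerSeries.X 1 + MvPowerSeries.X 0 ^ k) *
      (MvPowerSeries.X 1 + MvPowerSeries.X 0 ^ (w - k))) :
    LogCurve.Equivalent E F ∧
    LogCurve.ieaLog F = Ideal.span {MvPowerSeries.X 1, MvPowerSeries.X 0 ^ k} ∧
    LogCurve.iesLog F =
      ((Ideal.span {MvPowerSeries.X 1, MvPowerSeries.X 0 ^ k} : Ideal (LogCurve.Ser K)) :
        Set (LogCurve.Ser K)) ∧
    LogCurve.tauLog E = k ∧ LogCurve.tauEsLog E = k := by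
  have hkn : k < w - k := by omega
  obtain ⟨c, φ, β, v, u, hφ0, hφ1, hβ, hv, hu, rfl⟩ := hE.exists_sheared_eq hk hw hkw
  have hEF : LogCurve.Equivalent
      (φ ((X 1 + X 0 ^ (w - k) * LogCurve.inX β) * (X 1 + X 0 ^ k * LogCurve.inX v) * u)) F := by
    rw [hF]
    refine .trans ?_ (LogCurve.equivalent_normalForm hkn hβ hv hu)
    refine LogCurve.equivalent_of_apply_eq (φ := φ.symm) (u := 1) (v := 1) isUnit_one isUnit_one
      ?_ ?_
    · rw [mul_one, AlgEquiv.symm_apply_eq, hφ1]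
    · rw [mul_one, AlgEquiv.symm_apply_apply]
  have hiea : LogCurve.ieaLog F = Ideal.span {X 1, X 0 ^ k} := hF ▸ LogCurve.ieaLog_eq hk hkn
  refine ⟨hEF, hiea, LogCurve.iesLog_eq hk hkn (hF ▸ LogCurve.branchType_normalForm hkn), ?_, ?_⟩
  · rw [hEF.tauLog_eq, LogCurve.tauLog, hiea, LogCurve.finrank_quotient_span_X_one_X_zero_pow]
  · have hφcc : ∀ f : LogCurve.Ser K, constantCoeff f ≠ 0 → constantCoeff (φ f) ≠ 0 :=
      fun f hf => (LogCurve.constantCoeff_algEquiv_eq_zero φ).not.mpr hf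
    refine LogCurve.tauEsLog_eq hk hkn ?_
    rw [map_mul, map_mul, map_add, map_add, map_mul, map_mul, map_pow, map_pow, hφ0, hφ1]
    refine LogCurve.branchType_sheared hk hkn c (hφcc _ ?_) (hφcc _ ?_) (hφcc _ ?_)
    · rwa [LogCurve.constantCoeff_inX]
    · rwa [LogCurve.constantCoeff_inX]
    · exact (isUnit_iff_constantCoeff.mp hu).ne_zero
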